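/- Let $K$ be an algebraically closed field of characteristic $0$ and $S=K[x_1,\dots,x_4]$ the homogeneous coordinate ring of $\mathbb P^3$. Let $\mathrm{in}$ denote the initial ideal for the degree reverse lexicographic order with $x_1>x_2>x_3>x_4$, and let $\mathrm{gin}(J)$ be the generic initial ideal of a homogeneous ideal $J$, i.e. $\mathrm{in}(g\cdot J)$ for a generic linear change of coordinates $g$. For a radical homogeneous ideal $I\subset S$ let $I^{(m)}=S\cap\bigcap_{Q\in\mathrm{Ass}(I)}(I^m)_Q$ be its $m$-th symbolic power, let $\mathrm{HP}_{I^{(m)}}$ be the Hilbert polynomial of $S/I^{(m)}$, and let $$\mathrm{aHP}_I(t)=\lim_{m\to\infty}\frac{\mathrm{HP}_{I^{(m)}}(mt)}{m^3}$$ be the asymptotic Hilbert polynomial. Let $L_m\subset\mathbb R^3$ be the union of the sets $\alpha+\mathbb R^3_{\ge 0}$ over all $\alpha=(\alpha_1,\alpha_2,\alpha_3)\in\mathbb Z_{\ge0}^3$ with $x_1^{\alpha_1}x_2^{\alpha_2}x_3^{\alpha_3}\in\mathrm{gin}(I^{(m)})$, and let $$\Gamma(I)=\overline{\bigcap_{m\ge1}\Bigl(\mathbb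 R^3_{\ge0}\setminus\tfrac1m\,\mathrm{conv}(L_m)\Bigr)}.$$ Let $I$ be the ideal of the union of two disjoint lines in $\mathbb P^3$. Then the limit defining $\mathrm{aHP}_I(t)$ exists for every real $t$, and $\mathrm{aHP}_I(t)=t-\tfrac23$. The set $\Gamma(I)$ is the union of the unbounded cylinder $T\times[0,\infty)$, where $T\subset\mathbb R^2$ is the triangle with vertices $(0,0),(1,0),(0,2)$, and of the pyramid with base the triangle with vertices $(1,0,0),(2,0,0),(0,2,0)$ and apex $(1,0,1)$. Moreover $\mathrm{gin}(I)\supseteq(x_1x_3,\,x_2^2,\,x_1x_2,\,x_1^2)$. Furthermore, two generic lines (two lines spanned by two pairs of points of $K^4$ whose $16$ coordinates lie outside the zero set of some nonzero polynomial) are disjoint, and their ideal $I$ satisfies $\mathrm{in}(I)\supseteq(x_1x_3,\,x_2^2,\,x_1x_2,\,x_1^2)$. -/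

import Mathlib

open MvPolynomial Filter Topology
open scoped Pointwise

noncomputable section

namespace AsymptoticHilbert

/-- The symbolic power `I^(m) = R ∩ ⋂_{Q ∈ Ass(R/I)} (I^m)_Q`: the intersection of the contractions
to `R` of the extensions of `I ^ m` to the localizations at the associated primes of `I`. -/
def symbolicPower {R : Type*} [CommRing R] (I : Ideal R) (m : ℕ) : Ideal R :=
  ⨅ Q : associatedPrimes R (R ⧸ I),
    ((I ^ m).map (algebraMap R (Localization.AtPrime Q.1))).comap
      (algebraMap R (Localization.AtPrime Q.1))

/-- `DegRevLexLT α β` says `x^α < x^β` in the degree reverse lexicographic order with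
`x_0 > x_1 > ... > x_{k-1}`: either `|α| < |β|`, or `|α| = |β|` and at the last index where the
exponents differ, `α` has the larger exponent. -/
def DegRevLexLT {k : ℕ} (α β : Fin k →₀ ℕ) : Prop :=
  α.degree < β.degree ∨
    (α.degree = β.degree ∧ ∃ i, β i < α i ∧ ∀ j, i < j → α j = β j)

/-- `x^α` is the leading monomial of `f` in the degree reverse lexicographic order. -/
def IsLeadingExponent {K : Type*} [Field K] {k : ℕ} (f : MvPolynomial (Fin k) K)
    (α : Fin k →₀ ℕ) : Prop :=
  α ∈ f.support ∧ ∀ β ∈ f.support, β ≠ α → DegRevLexLT β α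

/-- The initial ideal `in(I)` for the degree reverse lexicographic order. -/
def initialIdeal {K : Type*} [Field K] {k : ℕ} (I : Ideal (MvPolynomial (Fin k) K)) :
    Ideal (MvPolynomial (Fin k) K) :=
  Ideal.span {p | ∃ f ∈ I, ∃ α, IsLeadingExponent f α ∧ p = monomial α 1}

/-- `Q` holds for a generic point of the affine space `K^σ`: it holds at all points of some nonempty
principal Zariski open set (over an infinite field). -/
def Generically {K : Type*} [Field K] {σ : Type*} (Q : (σ → K) → Prop) : Prop :=
  ∃ P : MvPolynomial σ K, P ≠ 0 ∧ ∀ a, eval a P ≠ 0 → Q a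

/-- The linear substitution `x_i ↦ ∑_j g_{ij} x_j`. -/
def linearChange {K : Type*} [Field K] {k : ℕ} (g : Fin k × Fin k → K) :
    MvPolynomial (Fin k) K →ₐ[K] MvPolynomial (Fin k) K :=
  aeval fun i => ∑ j, C (g (i, j)) * X j

/-- The generic initial ideal `gin(I)`: the monomial ideal spanned by those monomials that lie in
the initial ideal of `g · I` for a generic linear change of coordinates `g` (a generic matrix is
invertible, as the determinant is a nonzero polynomial in its entries). For homogeneous `I` over an
infinite field this is the common value of `in(g · I)` for generic `g`. -/
def gin {K : Type*} [Field K] {k : ℕ} (I : Ideal (MvPolynomial (Fin k) K)) :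
    Ideal (MvPolynomial (Fin k) K) :=
  Ideal.span {p | ∃ α : Fin k →₀ ℕ, p = monomial α 1 ∧
    Generically fun g : Fin k × Fin k → K =>
      monomial α 1 ∈ initialIdeal (I.map (linearChange g))}

/-- The set `L_m ⊆ ℝ^n`, the union of the orthants `α + ℝ^n_{≥ 0}` over the monomials `x^α` of
`gin(I^(m))` in the first `n` variables, for `I ⊆ K[x_0, ..., x_n]`. -/
def exponentRegion {K : Type*} [Field K] {n : ℕ} (I : Ideal (MvPolynomial (Fin (n + 1)) K))
    (m : ℕ) : Set (Fin n → ℝ) :=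
  {v | ∃ α : Fin (n + 1) →₀ ℕ, α (Fin.last n) = 0 ∧ monomial α 1 ∈ gin (symbolicPower I m) ∧
    ∀ i : Fin n, (α i.castSucc : ℝ) ≤ v i}

/-- `Γ(I)`, the closure of `⋂_{m ≥ 1} (ℝ^n_{≥ 0} \ conv(L_m) / m)`. -/
def Gam {K : Type*} [Field K] {n : ℕ} (I : Ideal (MvPolynomial (Fin (n + 1)) K)) :
    Set (Fin n → ℝ) :=
  closure (⋂ m : ℕ, ⋂ _ : 1 ≤ m,
    {v : Fin n → ℝ | ∀ i, 0 ≤ v i} \ ((m : ℝ)⁻¹ • convexHull ℝ (exponentRegion I m)))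

/-- The Hilbert function `t ↦ dim_K (K[x]_t / I_t)`. -/
def hilbertFunction {K : Type*} [Field K] {k : ℕ} (I : Ideal (MvPolynomial (Fin k) K)) (t : ℕ) :
    ℕ :=
  Module.finrank K (homogeneousSubmodule (Fin k) K t ⧸
    (I.restrictScalars K).comap (homogeneousSubmodule (Fin k) K t).subtype)

/-- `p` is the Hilbert polynomial of `I`. -/
def IsHilbertPolynomial {K : Type*} [Field K] {k : ℕ} (I : Ideal (MvPolynomial (Fin k) K))
    (p : Polynomial ℝ) : Prop :=
  ∀ᶠ t : ℕ in atTop, p.eval (t : ℝ) = hilbertFunction I t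

/-- `F` is the asymptotic Hilbert polynomial of `I ⊆ K[x_0, ..., x_n]`: all symbolic powers `I^(m)`
have Hilbert polynomials, and `F(t) = lim_m HP_{I^(m)}(m t) / m^n` for all `t`. -/
def IsAsymptoticHilbertPolynomial {K : Type*} [Field K] {n : ℕ}
    (I : Ideal (MvPolynomial (Fin (n + 1)) K)) (F : ℝ → ℝ) : Prop :=
  ∃ HP : ℕ → Polynomial ℝ,
    (∀ m, IsHilbertPolynomial (symbolicPower I m) (HP m)) ∧
    ∀ t : ℝ, Tendsto (fun m : ℕ => (HP m).eval ((m : ℝ) * t) / (m : ℝ) ^ n) atTop (𝓝 (F t))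

/-- The ideal of the union of the linear subspaces `ℙ(W₁)` and `ℙ(W₂)` of `ℙ(K^k)`: the polynomials
vanishing on the affine cone `W₁ ∪ W₂`. -/
def idealOfTwo {K : Type*} [Field K] {k : ℕ} (W₁ W₂ : Submodule K (Fin k → K)) :
    Ideal (MvPolynomial (Fin k) K) :=
  vanishingIdeal K ((W₁ : Set (Fin k → K)) ∪ W₂)

/-- `ℙ(W₁)` and `ℙ(W₂)` are disjoint lines in `ℙ(K^k)`. -/
def AreDisjointLines {K : Type*} [Field K] {k : ℕ} (W₁ W₂ : Submodule K (Fin k → K)) : Prop :=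
  Module.finrank K W₁ = 2 ∧ Module.finrank K W₂ = 2 ∧ W₁ ⊓ W₂ = ⊥

/-- The unbounded cylinder over the triangle `(0,0,0), (1,0,0), (0,2,0)`, upwards in the third
coordinate direction. -/
def cylinder : Set (Fin 3 → ℝ) :=
  {v | ∃ p ∈ convexHull ℝ {![0, 0, 0], ![1, 0, 0], ![0, 2, 0]}, ∃ s : ℝ, 0 ≤ s ∧
    v = p + s • ![0, 0, 1]}

/-- The pyramid over the triangle `(1,0,0), (2,0,0), (0,2,0)` with apex `(1,0,1)`. -/
def pyramid : Set (Fin 3 → ℝ) :=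
  convexHull ℝ {![1, 0, 0], ![2, 0, 0], ![0, 2, 0], ![1, 0, 1]}

end AsymptoticHilbert

end

/-! Choose linear coordinates `y = M x` in which the lines are `y₀ = y₁ = 0` and `y₂ = y₃ = 0`.
Powers of an ideal generated by variables are primary, so `I^(m)` is the intersection of the `m`-th
powers of the two line ideals, and in the coordinates `y` it is spanned by the monomials with `β₀ +
β₁ ≥ m` and `β₂ + β₃ ≥ m` (`IsSplitting.mem_symbolicPower_iff`). Counting the other monomials of
degree `t` gives the Hilbert polynomial, and its terms of order `m³` at `mt` give `t - 2/3`.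

For `Γ(I)`, let `D` be the polyhedron `v ≥ 0`, `2v₀ + v₁ ≥ 2`, `v₀ + v₁ + v₂ ≥ 2`. Products of
linear forms through the two lines give quadrics whose leading monomials include `x₀²`, `x₁²`,
`x₀x₂` (`span_le_initialIdeal_of_mul_mem`), so `conv(L₁)` already contains `D`.

Conversely `conv(L_m)/m` lies in `D` for every `m ≥ 1` (`IsSplitting.two_mul_le_of_mem_gin`). The
bound on the total degree holds because elements of `I^(m)` vanish to order `2m` at the origin. The
bound `2α₀ + α₁ ≥ 2m` comes from cutting with the plane `x₃ = 0`, where the lines become two points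
of multiplicity `m`; splitting off the line through them, or counting zeros on it, proves the
estimate `two_mul_le_of_X_pow_dvd_expandAt`. Hence `Γ(I)` is the closure of the complement of `D` in
the orthant, which is the cylinder together with the pyramid. -/

namespace AsymptoticHilbert

/-! ### Symbolic powers of an intersection of two incomparable primes. -/

section SymbolicPower

variable {R : Type*} [CommRing R]

/-- The class of any `s ∈ P₂ \ P₁` has annihilator exactly `P₁`. -/
theorem isAssociatedPrime_quotient_inf_left {P₁ P₂ : Ideal R} (h₁ : P₁.IsPrime)
    (h₂₁ : ¬ P₂ ≤ P₁) : P₁ ∈ associatedPrimes R (R ⧸ (P₁ ⊓ P₂)) := by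
  obtain ⟨s, hs₂, hs₁⟩ := SetLike.not_le_iff_exists.mp h₂₁
  refine ⟨h₁, Ideal.Quotient.mk _ s, ?_⟩
  have key : P₁ = Submodule.colon (⊥ : Submodule R (R ⧸ (P₁ ⊓ P₂))) {Ideal.Quotient.mk _ s} := by
    ext r
    rw [Submodule.mem_colon_singleton, Submodule.mem_bot, ← Ideal.Quotient.mk_eq_mk,
      ← Submodule.Quotient.mk_smul, Submodule.Quotient.mk_eq_zero]
    exact ⟨fun hr => ⟨P₁.mul_mem_right _ hr, P₂.mul_mem_left _ hs₂⟩,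
      fun hr => (h₁.mem_or_mem hr.1).resolve_right hs₁⟩
  rw [← key, h₁.radical]

theorem associatedPrimes_quotient_inf {P₁ P₂ : Ideal R} (h₁ : P₁.IsPrime) (h₂ : P₂.IsPrime)
    (h₁₂ : ¬ P₁ ≤ P₂) (h₂₁ : ¬ P₂ ≤ P₁) :
    associatedPrimes R (R ⧸ (P₁ ⊓ P₂)) = {P₁, P₂} := by
  ext Q
  constructor
  · rintro ⟨hQ, x, hx⟩
    obtain ⟨f, rfl⟩ := Ideal.Quotient.mk_surjective x
    -- The exponent `n` appears because an associated prime is here the radical of a colon ideal.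
    have hmem (r : R) : r ∈ Q ↔ ∃ n, r ^ n * f ∈ P₁ ⊓ P₂ := by
      rw [hx, Ideal.mem_radical_iff]
      refine exists_congr fun n => ?_
      rw [Submodule.mem_colon_singleton, Submodule.mem_bot, ← Ideal.Quotient.mk_eq_mk,
      ← Submodule.Quotient.mk_smul, Submodule.Quotient.mk_eq_zero, smul_eq_mul]
    have hle (P : Ideal R) (hP : P.IsPrime) (hP' : P₁ ⊓ P₂ ≤ P) (hf : f ∉ P) : Q ≤ P := by
      intro r hr
      obtain ⟨n, hn⟩ := (hmem r).1 hr
      exact hP.mem_of_pow_mem n ((hP.mem_or_mem (hP' hn)).resolve_right hf)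
    have hge : P₁ ⊓ P₂ ≤ Q := fun r hr =>
      (hmem r).2 ⟨1, by simpa using Ideal.mul_mem_right f _ hr⟩
    have hone : f ∈ P₁ → f ∉ P₂ := fun hf₁ hf₂ => hQ.ne_top <|
      (Ideal.eq_top_iff_one _).2 <| (hmem 1).2 ⟨0, by simpa using ⟨hf₁, hf₂⟩⟩
    rcases (hQ.inf_le).1 hge with h | h
    · by_cases hf : f ∈ P₁
      · exact absurd (h.trans (hle P₂ h₂ inf_le_right (hone hf))) h₁₂
      · exact Or.inl ((hle P₁ h₁ inf_le_left hf).antisymm h)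
    · by_cases hf : f ∈ P₂
      · exact absurd (h.trans (hle P₁ h₁ inf_le_left fun h => hone h hf)) h₂₁
      · exact Or.inr ((hle P₂ h₂ inf_le_right hf).antisymm h)
  · rintro (rfl | rfl)
    · exact isAssociatedPrime_quotient_inf_left h₁ h₂₁
    · rw [inf_comm]
      exact isAssociatedPrime_quotient_inf_left h₂ h₁₂

/-- Localizing at `P₁` turns `P₂` into the unit ideal, and `hprim` says that `P₁ ^ m` is its own
contraction. -/
theorem comap_map_localization_inf_pow {P₁ P₂ : Ideal R} [h₁ : P₁.IsPrime] (h₂₁ : ¬ P₂ ≤ P₁) (m : ℕ)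
    (hprim : ∀ s ∉ P₁, ∀ f, s * f ∈ P₁ ^ m → f ∈ P₁ ^ m) :
    (((P₁ ⊓ P₂) ^ m).map (algebraMap R (Localization.AtPrime P₁))).comap
      (algebraMap R (Localization.AtPrime P₁)) = P₁ ^ m := by
  ext f
  rw [Ideal.mem_comap, IsLocalization.algebraMap_mem_map_algebraMap_iff P₁.primeCompl]
  constructor
  · rintro ⟨s, hs, hsf⟩
    exact hprim s hs f (Ideal.pow_right_mono inf_le_left m hsf)
  · intro hf
    obtain ⟨s, hs₂, hs₁⟩ := SetLike.not_le_iff_exists.mp h₂₁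
    refine ⟨s ^ m, fun h => hs₁ (h₁.mem_of_pow_mem m h), ?_⟩
    refine Ideal.pow_right_mono Ideal.mul_le_inf m ?_
    rw [mul_comm (s ^ m), mul_pow]
    exact Ideal.mul_mem_mul hf (Ideal.pow_mem_pow hs₂ m)

theorem symbolicPower_inf {P₁ P₂ : Ideal R} (h₁ : P₁.IsPrime) (h₂ : P₂.IsPrime)
    (h₁₂ : ¬ P₁ ≤ P₂) (h₂₁ : ¬ P₂ ≤ P₁) (m : ℕ)
    (hprim₁ : ∀ s ∉ P₁, ∀ f, s * f ∈ P₁ ^ m → f ∈ P₁ ^ m)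
    (hprim₂ : ∀ s ∉ P₂, ∀ f, s * f ∈ P₂ ^ m → f ∈ P₂ ^ m) :
    symbolicPower (P₁ ⊓ P₂) m = P₁ ^ m ⊓ P₂ ^ m := by
  have hass := associatedPrimes_quotient_inf h₁ h₂ h₁₂ h₂₁
  have e (Q : associatedPrimes R (R ⧸ (P₁ ⊓ P₂))) :
      (((P₁ ⊓ P₂) ^ m).map (algebraMap R (Localization.AtPrime Q.1))).comap
        (algebraMap R (Localization.AtPrime Q.1)) = Q.1 ^ m := by
    obtain ⟨Q, hQ⟩ := Q
    have hQ' : Q = P₁ ∨ Q = P₂ := by simpa [hass] using hQ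
    rcases hQ' with rfl | rfl
    · exact comap_map_localization_inf_pow h₂₁ m hprim₁
    · have h := comap_map_localization_inf_pow h₁₂ m hprim₂
      rw [inf_comm] at h
      exact h
  rw [symbolicPower, iInf_congr e]
  apply le_antisymm
  · exact le_inf (iInf_le _ (⟨P₁, by rw [hass]; simp⟩ : associatedPrimes R (R ⧸ (P₁ ⊓ P₂))))
      (iInf_le _ (⟨P₂, by rw [hass]; simp⟩ : associatedPrimes R (R ⧸ (P₁ ⊓ P₂))))
  · refine le_iInf ?_
    rintro ⟨Q, hQ⟩
    have hQ' : Q = P₁ ∨ Q = P₂ := by simpa [hass] using hQ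
    rcases hQ' with rfl | rfl
    · exact inf_le_left
    · exact inf_le_right

end SymbolicPower

/-! ### Powers of the ideal of a coordinate subspace. -/

section CoordinateSubspace

variable {K : Type*} [Field K] {σ : Type*} [DecidableEq σ]

/-- The substitution which multiplies the variables in `s` by a new variable. -/
noncomputable def scaleHom (s : Finset σ) :
    MvPolynomial σ K →ₐ[K] Polynomial (MvPolynomial σ K) :=
  aeval fun i => Polynomial.C (X i) * if i ∈ s then Polynomial.X else 1

theorem scaleHom_monomial [Fintype σ] (s : Finset σ) (β : σ →₀ ℕ) (c : K) :
    scaleHom s (monomial β c) = Polynomial.C (monomial β c) * Polynomial.X ^ ∑ i ∈ s, β i := by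
  rw [scaleHom, aeval_monomial, Finsupp.prod_fintype _ _ (by simp)]
  simp_rw [mul_pow]
  rw [Finset.prod_mul_distrib, monomial_eq, Finsupp.prod_fintype _ _ (by simp)]
  simp only [ite_pow, one_pow, Finset.prod_ite_mem, Finset.univ_inter, map_mul, map_prod, map_pow,
    Finset.prod_pow_eq_pow_sum, mul_assoc]
  rfl

theorem coeff_coeff_scaleHom [Fintype σ] (s : Finset σ) (f : MvPolynomial σ K) (n : ℕ)
    (β : σ →₀ ℕ) : coeff β ((scaleHom s f).coeff n) = if ∑ i ∈ s, β i = n then coeff β f else 0 := by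
  induction f using MvPolynomial.induction_on' with
  | monomial γ c =>
    rw [scaleHom_monomial, Polynomial.coeff_C_mul_X_pow, coeff_monomial]
    by_cases h : γ = β
    · subst h
      split_ifs <;> simp_all
    · split_ifs <;> simp [h]
  | add p q hp hq =>
    rw [map_add, Polynomial.coeff_add, coeff_add, hp, hq, coeff_add]
    split_ifs <;> simp

/-- The order of `scaleHom s f` in the new variable is the order of vanishing of `f` along the
coordinate subspace. Primality of the ideal and primariness of its powers then reduce to primality
of that variable. -/
theorem X_pow_dvd_scaleHom_iff [Fintype σ] (s : Finset σ) (f : MvPolynomial σ K) (m : ℕ) :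
    Polynomial.X ^ m ∣ scaleHom s f ↔ ∀ β ∈ f.support, m ≤ ∑ i ∈ s, β i := by
  rw [Polynomial.X_pow_dvd_iff]
  constructor
  · intro h β hβ
    by_contra! hlt
    have := coeff_coeff_scaleHom s f (∑ i ∈ s, β i) β
    rw [h _ hlt, if_pos rfl] at this
    exact mem_support_iff.1 hβ this.symm
  · intro h n hn
    ext β
    rw [coeff_coeff_scaleHom, coeff_zero]
    split_ifs with hβ
    · by_contra hne
      have := h β (mem_support_iff.2 hne)
      omega
    · rfl

/-- The ideal of the coordinate subspace on which the variables in `s` vanish. -/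
def coordIdeal (K : Type*) [Field K] {σ : Type*} (s : Finset σ) : Ideal (MvPolynomial σ K) :=
  vanishingIdeal K {x : σ → K | ∀ i ∈ s, x i = 0}

theorem X_mem_coordIdeal {K : Type*} [Field K] {σ : Type*} {s : Finset σ} {i : σ} (hi : i ∈ s) :
    X i ∈ coordIdeal K s := by
  intro x hx
  simpa using hx i hi

variable [Infinite K]

/-- The constant coefficient of `scaleHom s f` is `f` with the variables in `s` set to zero. Over an
infinite field this polynomial is zero as soon as all its values are. -/
theorem mem_coordIdeal_iff (s : Finset σ) (f : MvPolynomial σ K) :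
    f ∈ coordIdeal K s ↔ Polynomial.X ∣ scaleHom s f := by
  have h0 : (scaleHom s f).coeff 0 = aeval (fun i => if i ∈ s then 0 else X i) f := by
    rw [← Polynomial.constantCoeff_apply]
    have : (Polynomial.constantCoeff (R := MvPolynomial σ K)).comp
        ((scaleHom s : MvPolynomial σ K →ₐ[K] _) : MvPolynomial σ K →+* _) =
        ((aeval (fun i => if i ∈ s then 0 else X i) :
          MvPolynomial σ K →ₐ[K] MvPolynomial σ K) : MvPolynomial σ K →+* MvPolynomial σ K) := by
      apply MvPolynomial.ringHom_ext
      · intro c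
        simp [scaleHom, MvPolynomial.algebraMap_eq, Polynomial.algebraMap_apply]
      · intro i
        simp [scaleHom]
        split_ifs <;> simp
    exact DFunLike.congr_fun this f
  have h1 (x : σ → K) : aeval x (aeval (R := K)
        (fun i => if i ∈ s then (0 : MvPolynomial σ K) else X i) f) =
      aeval (fun i => if i ∈ s then (0 : K) else x i) f := by
    rw [comp_aeval_apply]
    congr 2
    funext i
    split_ifs <;> simp
  rw [Polynomial.X_dvd_iff, h0]
  constructor
  · intro hf
    refine MvPolynomial.funext fun x => ?_
    rw [map_zero, ← aeval_eq_eval, h1]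
    exact hf _ fun i hi => if_pos hi
  · intro hf x hx
    have := h1 x
    rw [hf, map_zero] at this
    rw [this]
    congr 2
    funext i
    split_ifs with hi
    · exact hx i hi
    · rfl

theorem mem_coordIdeal_pow_iff [Fintype σ] (s : Finset σ) (f : MvPolynomial σ K) (m : ℕ) :
    f ∈ coordIdeal K s ^ m ↔ ∀ β ∈ f.support, m ≤ ∑ i ∈ s, β i := by
  rw [← X_pow_dvd_scaleHom_iff]
  constructor
  · intro hf
    have hle : coordIdeal K s ≤ (Ideal.span {Polynomial.X}).comap (scaleHom s) := fun f hf =>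
      Ideal.mem_span_singleton.2 ((mem_coordIdeal_iff s f).1 hf)
    have := Ideal.pow_right_mono hle m hf
    have := Ideal.le_comap_pow _ m this
    rwa [Ideal.span_singleton_pow, Ideal.mem_comap, Ideal.mem_span_singleton] at this
  · rw [X_pow_dvd_scaleHom_iff]
    intro h
    rw [f.as_sum]
    refine sum_mem fun β hβ => ?_
    rw [monomial_eq, Finsupp.prod_fintype _ _ (by simp), ← Finset.prod_mul_prod_compl s]
    refine Ideal.mul_mem_left _ _ (Ideal.mul_mem_right _ _ ?_)
    refine Ideal.pow_le_pow_right (h β hβ) ?_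
    rw [← Finset.prod_pow_eq_pow_sum]
    exact Ideal.prod_mem_prod fun i hi => Ideal.pow_mem_pow (X_mem_coordIdeal hi) _

theorem mem_coordIdeal_pow_iff_X_pow_dvd [Fintype σ] (s : Finset σ) (f : MvPolynomial σ K) (m : ℕ) :
    f ∈ coordIdeal K s ^ m ↔ Polynomial.X ^ m ∣ scaleHom s f := by
  rw [mem_coordIdeal_pow_iff, X_pow_dvd_scaleHom_iff]

theorem coordIdeal_isPrime (s : Finset σ) : (coordIdeal K s).IsPrime := by
  have : coordIdeal K s = (Ideal.span {Polynomial.X}).comap (scaleHom s) := by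
    ext f
    rw [mem_coordIdeal_iff, Ideal.mem_comap, Ideal.mem_span_singleton]
  rw [this]
  have : (Ideal.span {(Polynomial.X : Polynomial (MvPolynomial σ K))}).IsPrime :=
    (Ideal.span_singleton_prime Polynomial.X_ne_zero).2 Polynomial.prime_X
  exact Ideal.comap_isPrime _ _

theorem mem_coordIdeal_pow_of_mul_mem [Fintype σ] (s : Finset σ) (m : ℕ) (u : MvPolynomial σ K)
    (hu : u ∉ coordIdeal K s) (f : MvPolynomial σ K) (h : u * f ∈ coordIdeal K s ^ m) :
    f ∈ coordIdeal K s ^ m := by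
  rw [mem_coordIdeal_pow_iff_X_pow_dvd] at h ⊢
  rw [mem_coordIdeal_iff] at hu
  rw [map_mul] at h
  exact Polynomial.prime_X.pow_dvd_of_dvd_mul_left m hu h

end CoordinateSubspace

/-! ### Linear substitutions and their effect on ideals of linear subspaces. -/

section LinearChange

variable {K : Type*} [Field K] {k : ℕ}

theorem aeval_linearChange {A : Type*} [CommRing A] [Algebra K A] (g : Fin k × Fin k → K)
    (x : Fin k → A) (f : MvPolynomial (Fin k) K) :
    aeval x (linearChange g f) = aeval (fun i => ∑ j, algebraMap K A (g (i, j)) * x j) f := by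
  rw [linearChange, comp_aeval_apply]
  congr 2
  funext i
  simp

theorem linearChange_linearChange_of_mul_eq_one {M N : Matrix (Fin k) (Fin k) K} (h : M * N = 1)
    (f : MvPolynomial (Fin k) K) :
    linearChange (fun p => N p.1 p.2) (linearChange (fun p => M p.1 p.2) f) = f := by
  conv_lhs => rw [linearChange, aeval_linearChange]
  conv_rhs => rw [← aeval_X_left_apply f]
  congr 2
  funext i
  simp_rw [Finset.mul_sum]
  rw [Finset.sum_comm]
  have (y : Fin k) : ∑ x, algebraMap K (MvPolynomial (Fin k) K) (M i x) * (C (N x y) * X y) =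
      C ((M * N) i y) * X y := by
    rw [Matrix.mul_apply, map_sum, Finset.sum_mul]
    simp [MvPolynomial.algebraMap_eq, mul_assoc]
  simp only [this, h, Matrix.one_apply]
  simp [apply_ite]

/-- In the coordinates `y = M x` the polynomial `f` reads `f(N y)`, and `W` becomes a coordinate
subspace. -/
theorem mem_vanishingIdeal_iff_linearChange_mem {M N : Matrix (Fin k) (Fin k) K} (h : M * N = 1)
    (h' : N * M = 1) {W : Submodule K (Fin k → K)} {s : Finset (Fin k)}
    (hW : ∀ x, x ∈ W ↔ ∀ i ∈ s, M.mulVec x i = 0) (f : MvPolynomial (Fin k) K) :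
    f ∈ vanishingIdeal K (W : Set (Fin k → K)) ↔
      linearChange (fun p => N p.1 p.2) f ∈ coordIdeal K s := by
  have key (x : Fin k → K) : aeval x (linearChange (fun p => N p.1 p.2) f) =
      aeval (N.mulVec x) f := by
    rw [aeval_linearChange]
    rfl
  constructor
  · intro hf x hx
    rw [key]
    refine hf _ ((hW _).2 fun i hi => ?_)
    rw [Matrix.mulVec_mulVec, h, Matrix.one_mulVec]
    exact hx i hi
  · intro hf x hx
    have := hf (M.mulVec x) ((hW x).1 hx)
    rwa [key, Matrix.mulVec_mulVec, h', Matrix.one_mulVec] at this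

theorem mem_vanishingIdeal_pow_iff_linearChange_mem {M N : Matrix (Fin k) (Fin k) K}
    (h : M * N = 1) (h' : N * M = 1) {W : Submodule K (Fin k → K)} {s : Finset (Fin k)}
    (hW : ∀ x, x ∈ W ↔ ∀ i ∈ s, M.mulVec x i = 0) (m : ℕ) (f : MvPolynomial (Fin k) K) :
    f ∈ vanishingIdeal K (W : Set (Fin k → K)) ^ m ↔
      linearChange (fun p => N p.1 p.2) f ∈ coordIdeal K s ^ m := by
  have hinj : Function.Injective (linearChange fun p : Fin k × Fin k => N p.1 p.2) :=
    Function.LeftInverse.injective (linearChange_linearChange_of_mul_eq_one h')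
  have hsurj : Function.Surjective (linearChange fun p : Fin k × Fin k => N p.1 p.2) :=
    Function.RightInverse.surjective (linearChange_linearChange_of_mul_eq_one h)
  have hmap : (vanishingIdeal K (W : Set (Fin k → K))).map
      (linearChange fun p : Fin k × Fin k => N p.1 p.2) = coordIdeal K s := by
    have : vanishingIdeal K (W : Set (Fin k → K)) =
        (coordIdeal K s).comap (linearChange (fun p => N p.1 p.2)) :=
      Ideal.ext (mem_vanishingIdeal_iff_linearChange_mem h h' hW)
    rw [this, Ideal.map_comap_of_surjective _ hsurj]
  rw [← hmap, ← Ideal.map_pow, Ideal.mem_map_iff_of_surjective _ hsurj]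
  exact ⟨fun hf => ⟨f, hf, rfl⟩, fun ⟨x, hx, hxf⟩ => hinj hxf ▸ hx⟩

end LinearChange

/-! ### Coordinates adapted to two disjoint lines, and the symbolic powers in them. -/

section Splitting

variable {K : Type*} [Field K]

/-- The invertible matrix `M`, with inverse `N`, gives linear coordinates in which `W₁` is defined
by the vanishing of the first two coordinates and `W₂` by that of the last two. -/
structure IsSplitting (M N : Matrix (Fin 4) (Fin 4) K) (W₁ W₂ : Submodule K (Fin 4 → K)) :
    Prop where
  mul_eq_one : M * N = 1
  mul_eq_one' : N * M = 1
  mem_left : ∀ x, x ∈ W₁ ↔ ∀ i ∈ ({0, 1} : Finset (Fin 4)), M.mulVec x i = 0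
  mem_right : ∀ x, x ∈ W₂ ↔ ∀ i ∈ ({2, 3} : Finset (Fin 4)), M.mulVec x i = 0

theorem AreDisjointLines.exists_isSplitting {W₁ W₂ : Submodule K (Fin 4 → K)}
    (h : AreDisjointLines W₁ W₂) : ∃ M N, IsSplitting M N W₁ W₂ := by
  obtain ⟨h₁, h₂, h₁₂⟩ := h
  have hc : IsCompl W₂ W₁ := by
    refine (Submodule.isCompl_iff_disjoint _ _ ?_).2 (disjoint_iff.2 (by rwa [inf_comm]))
    simp [h₁, h₂]
  let b₁ := Module.finBasisOfFinrankEq K W₁ h₁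
  let b₂ := Module.finBasisOfFinrankEq K W₂ h₂
  let E := (Submodule.prodEquivOfIsCompl W₂ W₁ hc).symm
  -- The basis of `W₂` comes first: `W₁` is then the locus where the first two coordinates vanish.
  let b : Module.Basis (Fin 4) K (Fin 4 → K) :=
    ((b₂.prod b₁).map (Submodule.prodEquivOfIsCompl W₂ W₁ hc)).reindex finSumFinEquiv
  let L : (Fin 4 → K) ≃ₗ[K] (Fin 4 → K) := b.equivFun
  have hL (x : Fin 4 → K) : (LinearMap.toMatrix' L.toLinearMap).mulVec x = L x :=
    LinearMap.toMatrix'_mulVec _ _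
  have hl (x : Fin 4 → K) (i : Fin 2) : L x (finSumFinEquiv (m := 2) (n := 2) (.inl i)) =
      b₂.repr (E x).1 i := by
    simp [L, b, E]
  have hr (x : Fin 4 → K) (i : Fin 2) : L x (finSumFinEquiv (m := 2) (n := 2) (.inr i)) =
      b₁.repr (E x).2 i := by
    simp [L, b, E]
  refine ⟨LinearMap.toMatrix' L.toLinearMap, LinearMap.toMatrix' L.symm.toLinearMap, ?_, ?_, ?_, ?_⟩
  · rw [← LinearMap.toMatrix'_comp]; simp
  · rw [← LinearMap.toMatrix'_comp]; simp
  · intro x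
    have e : x ∈ W₁ ↔ (E x).1 = 0 := by
      rw [Submodule.prodEquivOfIsCompl_symm_apply_fst_eq_zero]
    rw [e, ← b₂.repr.map_eq_zero_iff, Finsupp.ext_iff]
    simp only [hL, Finset.mem_insert, Finset.mem_singleton, forall_eq_or_imp, forall_eq]
    rw [Fin.forall_fin_two]
    rw [← hl, ← hl]
    rfl
  · intro x
    have e : x ∈ W₂ ↔ (E x).2 = 0 := by
      rw [Submodule.prodEquivOfIsCompl_symm_apply_snd_eq_zero]
    rw [e, ← b₁.repr.map_eq_zero_iff, Finsupp.ext_iff]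
    simp only [hL, Finset.mem_insert, Finset.mem_singleton, forall_eq_or_imp, forall_eq]
    rw [Fin.forall_fin_two]
    rw [← hr, ← hr]
    rfl

theorem idealOfTwo_eq_inf {k : ℕ} (W₁ W₂ : Submodule K (Fin k → K)) :
    idealOfTwo W₁ W₂ = vanishingIdeal K (W₁ : Set (Fin k → K)) ⊓
      vanishingIdeal K (W₂ : Set (Fin k → K)) := by
  ext f
  simp only [idealOfTwo, Ideal.mem_inf, mem_vanishingIdeal_iff, Set.mem_union, or_imp, forall_and]

theorem not_vanishingIdeal_le {k : ℕ} {M N : Matrix (Fin k) (Fin k) K} (h : M * N = 1)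
    (h' : N * M = 1) {W W' : Submodule K (Fin k → K)} {s s' : Finset (Fin k)}
    (hW : ∀ x, x ∈ W ↔ ∀ i ∈ s, M.mulVec x i = 0) (hW' : ∀ x, x ∈ W' ↔ ∀ i ∈ s', M.mulVec x i = 0)
    {i : Fin k} (hi : i ∈ s) (hi' : i ∉ s') :
    ¬ vanishingIdeal K (W : Set (Fin k → K)) ≤ vanishingIdeal K (W' : Set (Fin k → K)) := by
  intro hle
  have hX := linearChange_linearChange_of_mul_eq_one h (X i)
  have h1 : linearChange (fun p => M p.1 p.2) (X i) ∈ vanishingIdeal K (W : Set (Fin k → K)) := by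
    rw [mem_vanishingIdeal_iff_linearChange_mem h h' hW, hX]
    exact X_mem_coordIdeal hi
  have h2 := hle h1
  rw [mem_vanishingIdeal_iff_linearChange_mem h h' hW', hX] at h2
  have := h2 (Pi.single i 1) fun j hj => Pi.single_eq_of_ne (by rintro rfl; exact hi' hj) _
  simp at this

variable [Infinite K] {M N : Matrix (Fin 4) (Fin 4) K} {W₁ W₂ : Submodule K (Fin 4 → K)}

theorem vanishingIdeal_isPrime_and_primary {k : ℕ} {M N : Matrix (Fin k) (Fin k) K} (h : M * N = 1)
    (h' : N * M = 1) {W : Submodule K (Fin k → K)} {s : Finset (Fin k)}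
    (hW : ∀ x, x ∈ W ↔ ∀ i ∈ s, M.mulVec x i = 0) (m : ℕ) :
    (vanishingIdeal K (W : Set (Fin k → K))).IsPrime ∧
      ∀ u ∉ vanishingIdeal K (W : Set (Fin k → K)), ∀ f,
        u * f ∈ vanishingIdeal K (W : Set (Fin k → K)) ^ m →
          f ∈ vanishingIdeal K (W : Set (Fin k → K)) ^ m := by
  have hp := coordIdeal_isPrime (K := K) s
  constructor
  · have : vanishingIdeal K (W : Set (Fin k → K)) =
        (coordIdeal K s).comap (linearChange (fun p => N p.1 p.2)) :=
      Ideal.ext (mem_vanishingIdeal_iff_linearChange_mem h h' hW)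
    rw [this]
    exact Ideal.comap_isPrime _ _
  · intro u hu f huf
    rw [mem_vanishingIdeal_pow_iff_linearChange_mem h h' hW] at huf ⊢
    rw [mem_vanishingIdeal_iff_linearChange_mem h h' hW] at hu
    rw [map_mul] at huf
    exact mem_coordIdeal_pow_of_mul_mem s m _ hu _ huf

theorem IsSplitting.symbolicPower_eq (h : IsSplitting M N W₁ W₂) (m : ℕ) :
    symbolicPower (idealOfTwo W₁ W₂) m = vanishingIdeal K (W₁ : Set (Fin 4 → K)) ^ m ⊓
      vanishingIdeal K (W₂ : Set (Fin 4 → K)) ^ m := by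
  obtain ⟨p₁, q₁⟩ := vanishingIdeal_isPrime_and_primary h.1 h.2 h.3 m
  obtain ⟨p₂, q₂⟩ := vanishingIdeal_isPrime_and_primary h.1 h.2 h.4 m
  rw [idealOfTwo_eq_inf]
  exact symbolicPower_inf p₁ p₂ (not_vanishingIdeal_le h.1 h.2 h.3 h.4 (i := 0) (by simp) (by simp))
    (not_vanishingIdeal_le h.1 h.2 h.4 h.3 (i := 2) (by simp) (by simp)) m q₁ q₂

theorem IsSplitting.mem_symbolicPower_iff (h : IsSplitting M N W₁ W₂) (m : ℕ)
    (f : MvPolynomial (Fin 4) K) : f ∈ symbolicPower (idealOfTwo W₁ W₂) m ↔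
      ∀ β ∈ (linearChange (fun p => N p.1 p.2) f).support, m ≤ β 0 + β 1 ∧ m ≤ β 2 + β 3 := by
  rw [h.symbolicPower_eq, Ideal.mem_inf, mem_vanishingIdeal_pow_iff_linearChange_mem h.1 h.2 h.3,
    mem_vanishingIdeal_pow_iff_linearChange_mem h.1 h.2 h.4, mem_coordIdeal_pow_iff,
    mem_coordIdeal_pow_iff, ← forall₂_and]
  simp

end Splitting

/-! ### Leading monomials of quadrics through two lines. -/

section Quadrics

variable {K : Type*} [Field K]

theorem isLeadingExponent_monomial_add {k : ℕ} {α : Fin k →₀ ℕ} {c : K} (hc : c ≠ 0)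
    {r : MvPolynomial (Fin k) K} (hr : r ∈ restrictSupport K {β | DegRevLexLT β α}) :
    IsLeadingExponent (monomial α c + r) α := by
  classical
  rw [mem_restrictSupport_iff] at hr
  have hα : coeff α r = 0 := by
    by_contra h
    rcases hr (mem_support_iff.2 h) with h | ⟨-, i, hi, -⟩ <;> simp at *
  refine ⟨by simp [hα, hc], fun β hβ hne => hr ?_⟩
  rw [mem_support_iff, coeff_add, coeff_monomial, if_neg hne.symm, zero_add] at hβ
  exact mem_support_iff.2 hβ

theorem monomial_mem_initialIdeal {k : ℕ} {J : Ideal (MvPolynomial (Fin k) K)} {α : Fin k →₀ ℕ}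
    {c : K} (hc : c ≠ 0) {r : MvPolynomial (Fin k) K}
    (hr : r ∈ restrictSupport K {β | DegRevLexLT β α}) (hJ : monomial α c + r ∈ J) :
    monomial α 1 ∈ initialIdeal J :=
  Ideal.subset_span ⟨_, hJ, α, isLeadingExponent_monomial_add hc hr, rfl⟩

theorem C_mul_X_mul_X_mem_restrictSupport {k : ℕ} {i j p q : Fin k} (c : K)
    (h : ∃ r, (if p = r then 1 else 0) + (if q = r then 1 else 0) <
        (if i = r then 1 else 0) + (if j = r then 1 else 0) ∧
      ∀ s, r < s → (if i = s then 1 else 0) + (if j = s then 1 else 0) =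
        (if p = s then 1 else 0) + (if q = s then 1 else 0)) :
    C c * (X i * X j) ∈ restrictSupport K
      {β : Fin k →₀ ℕ | DegRevLexLT β (Finsupp.single p 1 + Finsupp.single q 1)} := by
  rw [← smul_eq_C_mul]
  refine Submodule.smul_mem _ _ ?_
  have : (X i * X j : MvPolynomial (Fin k) K) =
      monomial (Finsupp.single i 1 + Finsupp.single j 1) 1 := by
    rw [X, X, monomial_mul, one_mul]
  rw [this, mem_restrictSupport_iff]
  intro β hβ
  obtain rfl := Finset.mem_singleton.1 (support_monomial_subset hβ)
  refine Or.inr ⟨by simp, ?_⟩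
  simpa [Finsupp.single_apply] using h

/-- Each line is given by two forms solved for `x₀` and `x₁`. Three of the products lead with `x₀²`,
`x₀x₁`, `x₁²`. In the difference of the two mixed products `x₀x₁` cancels, leaving `x₀x₂` with
coefficient `a * d₂ - c * b₂`. -/
theorem span_le_initialIdeal_of_mul_mem {J : Ideal (MvPolynomial (Fin 4) K)}
    {a a₂ a₃ b₂ b₃ c c₂ c₃ d₂ d₃ : K} (ha : a ≠ 0) (hc : c ≠ 0) (hne : a * d₂ - c * b₂ ≠ 0)
    (h₁ : (C a * X 0 + C a₂ * X 2 + C a₃ * X 3) * (C c * X 0 + C c₂ * X 2 + C c₃ * X 3) ∈ J)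
    (h₂ : (C a * X 0 + C a₂ * X 2 + C a₃ * X 3) * (C c * X 1 + C d₂ * X 2 + C d₃ * X 3) ∈ J)
    (h₃ : (C a * X 1 + C b₂ * X 2 + C b₃ * X 3) * (C c * X 0 + C c₂ * X 2 + C c₃ * X 3) ∈ J)
    (h₄ : (C a * X 1 + C b₂ * X 2 + C b₃ * X 3) * (C c * X 1 + C d₂ * X 2 + C d₃ * X 3) ∈ J) :
    Ideal.span {X 0 * X 2, X 1 ^ 2, X 0 * X 1, X 0 ^ 2} ≤ initialIdeal J := by
  have hXX (i j : Fin 4) (e : K) : (monomial (Finsupp.single i 1 + Finsupp.single j 1) e :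
      MvPolynomial (Fin 4) K) = C e * (X i * X j) := by
    rw [X, X, monomial_mul, C_mul_monomial, one_mul, mul_one]
  have hX (i j : Fin 4) : (monomial (Finsupp.single i 1 + Finsupp.single j 1) 1 :
      MvPolynomial (Fin 4) K) = X i * X j := by
    rw [hXX, map_one, one_mul]
  have hac := mul_ne_zero ha hc
  rw [Ideal.span_le]
  rintro p (rfl | rfl | rfl | rfl)
  · rw [SetLike.mem_coe, ← hX]
    refine monomial_mem_initialIdeal hne (r := C (a * d₃ - c * b₃) * (X 0 * X 3)
      + C (c * a₂ - a * c₂) * (X 1 * X 2) + C (c * a₃ - a * c₃) * (X 1 * X 3)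
      + C (a₂ * d₂ - b₂ * c₂) * (X 2 * X 2)
      + C (a₂ * d₃ + a₃ * d₂ - b₂ * c₃ - b₃ * c₂) * (X 2 * X 3)
      + C (a₃ * d₃ - b₃ * c₃) * (X 3 * X 3)) ?_ ?_
    · repeat' refine Submodule.add_mem _ ?_ ?_
      all_goals exact C_mul_X_mul_X_mem_restrictSupport _ (by decide)
    · convert J.sub_mem h₂ h₃ using 1
      rw [hXX]
      simp only [map_add, map_sub, map_mul]
      ring
  · rw [SetLike.mem_coe, sq, ← hX]
    refine monomial_mem_initialIdeal hac (r := C (a * d₂ + b₂ * c) * (X 1 * X 2)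
      + C (a * d₃ + b₃ * c) * (X 1 * X 3) + C (b₂ * d₂) * (X 2 * X 2)
      + C (b₂ * d₃ + b₃ * d₂) * (X 2 * X 3) + C (b₃ * d₃) * (X 3 * X 3)) ?_ ?_
    · repeat' refine Submodule.add_mem _ ?_ ?_
      all_goals exact C_mul_X_mul_X_mem_restrictSupport _ (by decide)
    · convert h₄ using 1
      rw [hXX]
      simp only [map_add, map_mul]
      ring
  · rw [SetLike.mem_coe, ← hX]
    refine monomial_mem_initialIdeal hac (r := C (a * d₂) * (X 0 * X 2)
      + C (a * d₃) * (X 0 * X 3) + C (a₂ * c) * (X 1 * X 2) + C (a₃ * c) * (X 1 * X 3)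
      + C (a₂ * d₂) * (X 2 * X 2)
      + C (a₂ * d₃ + a₃ * d₂) * (X 2 * X 3) + C (a₃ * d₃) * (X 3 * X 3)) ?_ ?_
    · repeat' refine Submodule.add_mem _ ?_ ?_
      all_goals exact C_mul_X_mul_X_mem_restrictSupport _ (by decide)
    · convert h₂ using 1
      rw [hXX]
      simp only [map_add, map_mul]
      ring
  · rw [SetLike.mem_coe, sq, ← hX]
    refine monomial_mem_initialIdeal hac (r := C (a * c₂ + a₂ * c) * (X 0 * X 2)
      + C (a * c₃ + a₃ * c) * (X 0 * X 3) + C (a₂ * c₂) * (X 2 * X 2)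
      + C (a₂ * c₃ + a₃ * c₂) * (X 2 * X 3) + C (a₃ * c₃) * (X 3 * X 3)) ?_ ?_
    · repeat' refine Submodule.add_mem _ ?_ ?_
      all_goals exact C_mul_X_mul_X_mem_restrictSupport _ (by decide)
    · convert h₁ using 1
      rw [hXX]
      simp only [map_add, map_mul]
      ring

end Quadrics

/-! ### Generic coordinate changes and the quadrics in the generic initial ideal. -/

section GenericPosition

/-- The polynomial in the coefficients of four linear forms, the first two cutting out one line and
the last two another, whose nonvanishing means that the lines are in general position. -/
def positionForm {R : Type*} [CommRing R] (h : Matrix (Fin 4) (Fin 4) R) : R :=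
  (h 0 0 * h 1 1 - h 0 1 * h 1 0) * (h 2 0 * h 3 1 - h 2 1 * h 3 0) *
    ((h 0 0 * h 1 1 - h 0 1 * h 1 0) * (h 2 0 * h 3 2 - h 3 0 * h 2 2) -
      (h 2 0 * h 3 1 - h 2 1 * h 3 0) * (h 0 0 * h 1 2 - h 1 0 * h 0 2))

variable {K : Type*} [Field K]

theorem exists_eval_eq_positionForm {M N : Matrix (Fin 4) (Fin 4) K} (hMN : M * N = 1) :
    ∃ P : MvPolynomial (Fin 4 × Fin 4) K, P ≠ 0 ∧
      ∀ g, eval g P = positionForm (M * Matrix.of fun i j => g (i, j)) := by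
  refine ⟨positionForm (M.map C * Matrix.of fun i j => X (i, j)), ?_, ?_⟩
  all_goals
    have key (g : Fin 4 × Fin 4 → K) :
        eval g (positionForm (M.map C * Matrix.of fun i j => X (i, j))) =
          positionForm (M * Matrix.of fun i j => g (i, j)) := by
      simp [positionForm, Matrix.mul_apply]
  · intro h0
    -- All three factors of `positionForm` equal `1` at `h`, and the matrix `N * h` of substitutions
    -- realizes it.
    let h : Matrix (Fin 4) (Fin 4) K := !![1, 0, 0, 0; 0, 1, 0, 0; 1, 0, 0, 1; 0, 1, 1, 0]
    have := key fun p => (N * h) p.1 p.2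
    rw [h0, map_zero] at this
    have e : M * (Matrix.of fun i j => (N * h) i j) = h := by
      change M * (N * h) = h
      rw [← Matrix.mul_assoc, hMN, Matrix.one_mul]
    rw [e] at this
    simp [positionForm, h] at this
  · exact key

/-- Row reduction: the first two factors of `positionForm` are the minors needed to solve each pair
of forms for `x₀` and `x₁`, and the third is the resulting coefficient of `x₀x₂`. -/
theorem span_le_initialIdeal_of_positionForm {J : Ideal (MvPolynomial (Fin 4) K)}
    {h : Matrix (Fin 4) (Fin 4) K} (hh : positionForm h ≠ 0)
    (hJ : ∀ i ∈ ({0, 1} : Finset (Fin 4)), ∀ j ∈ ({2, 3} : Finset (Fin 4)),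
      (∑ l, C (h i l) * X l) * (∑ l, C (h j l) * X l) ∈ J) :
    Ideal.span {X 0 * X 2, X 1 ^ 2, X 0 * X 1, X 0 ^ 2} ≤ initialIdeal J := by
  have ha : h 0 0 * h 1 1 - h 0 1 * h 1 0 ≠ 0 := fun h0 => hh (by simp [positionForm, h0])
  have hc : h 2 0 * h 3 1 - h 2 1 * h 3 0 ≠ 0 := fun h0 => hh (by simp [positionForm, h0])
  have hne := right_ne_zero_of_mul hh
  have key (s t u v : K) : (C s * (∑ l, C (h 0 l) * X l) + C t * (∑ l, C (h 1 l) * X l)) *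
      (C u * (∑ l, C (h 2 l) * X l) + C v * (∑ l, C (h 3 l) * X l)) ∈ J := by
    have e (p q r w : MvPolynomial (Fin 4) K) : (C s * p + C t * q) * (C u * r + C v * w) =
        C (s * u) * (p * r) + C (s * v) * (p * w) + C (t * u) * (q * r) + C (t * v) * (q * w) := by
      simp only [map_mul]
      ring
    rw [e]
    refine J.add_mem (J.add_mem (J.add_mem ?_ ?_) ?_) ?_
    all_goals exact J.mul_mem_left _ (hJ _ (by simp) _ (by simp))
  have e₀ (i j : Fin 4) : C (h j 1) * (∑ l, C (h i l) * X l) + C (-h i 1) * (∑ l, C (h j l) * X l) =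
      C (h i 0 * h j 1 - h i 1 * h j 0) * X 0 + C (h i 2 * h j 1 - h i 1 * h j 2) * X 2 +
        C (h i 3 * h j 1 - h i 1 * h j 3) * (X 3 : MvPolynomial (Fin 4) K) := by
    simp only [Fin.sum_univ_four, map_sub, map_mul, map_neg]
    ring
  have e₁ (i j : Fin 4) : C (-h j 0) * (∑ l, C (h i l) * X l) + C (h i 0) * (∑ l, C (h j l) * X l) =
      C (h i 0 * h j 1 - h i 1 * h j 0) * X 1 + C (h i 0 * h j 2 - h j 0 * h i 2) * X 2 +
        C (h i 0 * h j 3 - h j 0 * h i 3) * (X 3 : MvPolynomial (Fin 4) K) := by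
    simp only [Fin.sum_univ_four, map_sub, map_mul, map_neg]
    ring
  have k₁ := key (h 1 1) (-h 0 1) (h 3 1) (-h 2 1)
  have k₂ := key (h 1 1) (-h 0 1) (-h 3 0) (h 2 0)
  have k₃ := key (-h 1 0) (h 0 0) (h 3 1) (-h 2 1)
  have k₄ := key (-h 1 0) (h 0 0) (-h 3 0) (h 2 0)
  rw [e₀, e₀] at k₁
  rw [e₀, e₁] at k₂
  rw [e₁, e₀] at k₃
  rw [e₁, e₁] at k₄
  exact span_le_initialIdeal_of_mul_mem ha hc hne k₁ k₂ k₃ k₄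

theorem IsSplitting.span_le_initialIdeal {M N : Matrix (Fin 4) (Fin 4) K}
    {W₁ W₂ : Submodule K (Fin 4 → K)} (h : IsSplitting M N W₁ W₂) (g : Fin 4 × Fin 4 → K)
    (hg : positionForm (M * Matrix.of fun i j => g (i, j)) ≠ 0) :
    Ideal.span {X 0 * X 2, X 1 ^ 2, X 0 * X 1, X 0 ^ 2} ≤
      initialIdeal ((idealOfTwo W₁ W₂).map (linearChange g)) := by
  refine span_le_initialIdeal_of_positionForm hg fun i hi j hj => ?_
  have e (i : Fin 4) : (∑ l, C ((M * Matrix.of fun i j => g (i, j)) i l) * X l :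
      MvPolynomial (Fin 4) K) = linearChange g (∑ l, C (M i l) * X l) := by
    simp only [linearChange, map_sum, map_mul, aeval_X, aeval_C, Matrix.mul_apply, Matrix.of_apply,
      MvPolynomial.algebraMap_eq, Finset.sum_mul, Finset.mul_sum]
    rw [Finset.sum_comm]
    simp only [mul_assoc]
  rw [e, e, ← map_mul]
  refine Ideal.mem_map_of_mem _ ?_
  have e' (x : Fin 4 → K) (i : Fin 4) : aeval x (∑ l, C (M i l) * X l) = M.mulVec x i := by
    simp [Matrix.mulVec, dotProduct]
  rintro x (hx | hx)
  · rw [map_mul, e', (h.mem_left x).1 hx i hi, zero_mul]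
  · rw [map_mul, e' x j, (h.mem_right x).1 hx j hj, mul_zero]

theorem monomials_mem_gin {k : ℕ} {I J : Ideal (MvPolynomial (Fin k) K)} {S : Set (Fin k →₀ ℕ)}
    (hJ : J = Ideal.span ((fun α => monomial α 1) '' S))
    (h : Generically fun g : Fin k × Fin k → K => J ≤ initialIdeal (I.map (linearChange g))) :
    J ≤ gin I := by
  obtain ⟨P, hP, hg⟩ := h
  subst hJ
  rw [Ideal.span_le]
  rintro _ ⟨α, hα, rfl⟩
  exact Ideal.subset_span ⟨α, rfl, P, hP, fun g h => hg g h (Ideal.subset_span ⟨α, hα, rfl⟩)⟩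

theorem span_quadrics_eq : (Ideal.span {X 0 * X 2, X 1 ^ 2, X 0 * X 1, X 0 ^ 2} :
    Ideal (MvPolynomial (Fin 4) K)) = Ideal.span ((fun α => monomial α 1) ''
      {Finsupp.single 0 1 + Finsupp.single 2 1, Finsupp.single 1 1 + Finsupp.single 1 1,
        Finsupp.single 0 1 + Finsupp.single 1 1, Finsupp.single 0 1 + Finsupp.single 0 1}) := by
  have hX (i j : Fin 4) : (monomial (Finsupp.single i 1 + Finsupp.single j 1) 1 :
      MvPolynomial (Fin 4) K) = X i * X j := by
    rw [X, X, monomial_mul, one_mul]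
  simp only [Set.image_insert_eq, Set.image_singleton, hX, sq]

theorem IsSplitting.span_le_gin {M N : Matrix (Fin 4) (Fin 4) K}
    {W₁ W₂ : Submodule K (Fin 4 → K)} (h : IsSplitting M N W₁ W₂) :
    Ideal.span {X 0 * X 2, X 1 ^ 2, X 0 * X 1, X 0 ^ 2} ≤ gin (idealOfTwo W₁ W₂) := by
  obtain ⟨P, hP, hPe⟩ := exists_eval_eq_positionForm h.mul_eq_one
  exact monomials_mem_gin span_quadrics_eq
    ⟨P, hP, fun g hg => h.span_le_initialIdeal g (by rwa [← hPe])⟩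

end GenericPosition

/-! ### Lines spanned by generic points, without a change of coordinates. -/

section GenericLines

variable {K : Type*} [Field K]

theorem areDisjointLines_of_det_ne_zero {A : Matrix (Fin 4) (Fin 4) K} (hA : A.det ≠ 0) :
    AreDisjointLines (Submodule.span K {A 0, A 1}) (Submodule.span K {A 2, A 3}) := by
  have hli := Matrix.linearIndependent_rows_of_det_ne_zero hA
  have hfin (i j : Fin 4) (hij : i ≠ j) :
      Module.finrank K (Submodule.span K ({A i, A j} : Set (Fin 4 → K))) = 2 := by
    have hinj : Function.Injective ![i, j] := by
      intro a b
      fin_cases a <;> fin_cases b <;> simp [hij, hij.symm]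
    have := finrank_span_eq_card (hli.comp _ hinj)
    have hr : Set.range ((fun i => A i) ∘ ![i, j]) = {A i, A j} := by
      rw [Set.range_comp, Matrix.range_cons, Matrix.range_cons, Matrix.range_empty, Set.union_empty,
        Set.singleton_union, Set.image_pair]
    rwa [hr, Fintype.card_fin] at this
  refine ⟨hfin 0 1 (by decide), hfin 2 3 (by decide), ?_⟩
  have := hli.disjoint_span_image (s := {0, 1}) (t := {2, 3}) (by simp [Set.disjoint_left])
  rw [Set.image_pair, Set.image_pair] at this
  exact this.eq_bot

theorem mem_vanishingIdeal_span_pair {k : ℕ} {p q : Fin k → K} {c : Fin k → K}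
    (hp : ∑ l, c l * p l = 0) (hq : ∑ l, c l * q l = 0) :
    ∑ l, C (c l) * X l ∈
      vanishingIdeal K (Submodule.span K {p, q} : Set (Fin k → K)) := by
  intro x hx
  obtain ⟨s, t, rfl⟩ := Submodule.mem_span_pair.1 hx
  have : aeval (s • p + t • q) (∑ l, C (c l) * X l) =
      s * ∑ l, c l * p l + t * ∑ l, c l * q l := by
    simp only [map_sum, map_mul, aeval_C, aeval_X, Finset.mul_sum, ← Finset.sum_add_distrib]
    refine Finset.sum_congr rfl fun l _ => ?_
    simp
    ring
  rw [this, hp, hq, mul_zero, mul_zero, add_zero]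

/-- The Plücker coordinates of the line spanned by `p` and `q`. -/
def pluckerCoord {R : Type*} [CommRing R] (p q : Fin 4 → R) (i j : Fin 4) : R :=
  p i * q j - p j * q i

/-- Evaluating these forms at `p` or `q` expands a `3 × 3` determinant with a repeated row. -/
theorem pluckerCoord_forms_mem_vanishingIdeal (p q : Fin 4 → K) :
    C (pluckerCoord p q 2 3) * X 0 + C (-pluckerCoord p q 0 3) * X 2 +
        C (pluckerCoord p q 0 2) * X 3 ∈
      vanishingIdeal K (Submodule.span K {p, q} : Set (Fin 4 → K)) ∧
    C (pluckerCoord p q 2 3) * X 1 + C (-pluckerCoord p q 1 3) * X 2 +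
        C (pluckerCoord p q 1 2) * X 3 ∈
      vanishingIdeal K (Submodule.span K {p, q} : Set (Fin 4 → K)) := by
  have h₀ := mem_vanishingIdeal_span_pair (p := p) (q := q)
    (c := ![pluckerCoord p q 2 3, 0, -pluckerCoord p q 0 3, pluckerCoord p q 0 2])
    (by simp [Fin.sum_univ_four, pluckerCoord]; ring)
    (by simp [Fin.sum_univ_four, pluckerCoord]; ring)
  have h₁ := mem_vanishingIdeal_span_pair (p := p) (q := q)
    (c := ![0, pluckerCoord p q 2 3, -pluckerCoord p q 1 3, pluckerCoord p q 1 2])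
    (by simp [Fin.sum_univ_four, pluckerCoord]; ring)
    (by simp [Fin.sum_univ_four, pluckerCoord]; ring)
  constructor
  · convert h₀ using 1
    simp [Fin.sum_univ_four]
  · convert h₁ using 1
    simp [Fin.sum_univ_four]

theorem span_le_initialIdeal_idealOfTwo_span {p q r s : Fin 4 → K}
    (h₁ : pluckerCoord p q 2 3 ≠ 0) (h₂ : pluckerCoord r s 2 3 ≠ 0)
    (h₃ : pluckerCoord p q 2 3 * pluckerCoord r s 1 3 -
      pluckerCoord r s 2 3 * pluckerCoord p q 1 3 ≠ 0) :
    Ideal.span {X 0 * X 2, X 1 ^ 2, X 0 * X 1, X 0 ^ 2} ≤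
      initialIdeal (idealOfTwo (Submodule.span K {p, q}) (Submodule.span K {r, s})) := by
  rw [idealOfTwo_eq_inf]
  obtain ⟨e₀, e₁⟩ := pluckerCoord_forms_mem_vanishingIdeal p q
  obtain ⟨f₀, f₁⟩ := pluckerCoord_forms_mem_vanishingIdeal r s
  refine span_le_initialIdeal_of_mul_mem h₁ h₂ (fun h0 => h₃ (by linear_combination -h0))
    (Ideal.mul_le_inf (Ideal.mul_mem_mul e₀ f₀)) (Ideal.mul_le_inf (Ideal.mul_mem_mul e₀ f₁))
    (Ideal.mul_le_inf (Ideal.mul_mem_mul e₁ f₀)) (Ideal.mul_le_inf (Ideal.mul_mem_mul e₁ f₁))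

theorem generically_span_le_initialIdeal : Generically (fun a : Fin 4 × Fin 4 → K =>
    AreDisjointLines
        (Submodule.span K {fun j => a (0, j), fun j => a (1, j)})
        (Submodule.span K {fun j => a (2, j), fun j => a (3, j)}) ∧
      Ideal.span {X 0 * X 2, X 1 ^ 2, X 0 * X 1, X 0 ^ 2} ≤
        initialIdeal (idealOfTwo
          (Submodule.span K {fun j => a (0, j), fun j => a (1, j)})
          (Submodule.span K {fun j => a (2, j), fun j => a (3, j)}))) := by
  let P (s t i j : Fin 4) : MvPolynomial (Fin 4 × Fin 4) K :=
    pluckerCoord (fun l => X (s, l)) (fun l => X (t, l)) i j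
  have hP (a) (s t i j : Fin 4) :
      eval a (P s t i j) = pluckerCoord (fun l => a (s, l)) (fun l => a (t, l)) i j := by
    simp [P, pluckerCoord]
  refine ⟨(Matrix.mvPolynomialX (Fin 4) (Fin 4) K).det * (P 0 1 2 3 * P 2 3 2 3 *
    (P 0 1 2 3 * P 2 3 1 3 - P 2 3 2 3 * P 0 1 1 3)), ?_, ?_⟩
  · refine mul_ne_zero (Matrix.det_mvPolynomialX_ne_zero _ _) fun h0 => ?_
    -- Both coordinates of index `2 3` are `1`, while those of index `1 3` are `0` and `1`, so the
    -- difference is `1`.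
    let A : Matrix (Fin 4) (Fin 4) K := !![0, 0, 1, 0; 0, 0, 0, 1; 1, 1, 1, 0; 0, 1, 0, 1]
    have := congrArg (eval fun x => A x.1 x.2) h0
    simp [hP, pluckerCoord, A] at this
  · intro a ha
    simp only [map_mul, map_sub, hP, mul_ne_zero_iff] at ha
    obtain ⟨hdet, ⟨h₁, h₂⟩, h₃⟩ := ha
    rw [RingHom.map_det] at hdet
    have hA : (eval a).mapMatrix (Matrix.mvPolynomialX (Fin 4) (Fin 4) K) =
        Matrix.of fun i j => a (i, j) := by
      ext i j
      simp
    rw [hA] at hdet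
    have hlines := areDisjointLines_of_det_ne_zero hdet
    have hspan := span_le_initialIdeal_idealOfTwo_span h₁ h₂ h₃
    exact ⟨hlines, hspan⟩

end GenericLines

/-! ### Plane curves with two points of multiplicity `m`. -/

section TwoPoints

variable {K : Type*} [Field K]

/-- The expansion of a polynomial in two variables around the point `p`, with a new variable which
multiplies the displacement: its order is the order of vanishing at `p`. -/
noncomputable def expandAt (p : Fin 2 → K) :
    MvPolynomial (Fin 2) K →ₐ[K] Polynomial (MvPolynomial (Fin 2) K) :=
  aeval fun i => Polynomial.C (C (p i)) + Polynomial.X * Polynomial.C (X i)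

/-- The substitution `x₀ ↦ x T`, `x₁ ↦ T`. -/
noncomputable def slopeHom : MvPolynomial (Fin 2) K →ₐ[K] Polynomial (Polynomial K) :=
  aeval ![Polynomial.C Polynomial.X * Polynomial.X, Polynomial.X]

theorem slopeHom_monomial (β : Fin 2 →₀ ℕ) (c : K) :
    slopeHom (monomial β c) =
      Polynomial.monomial (β 0 + β 1) (Polynomial.monomial (β 0) c) := by
  rw [slopeHom, aeval_monomial, Finsupp.prod_fintype _ _ (by simp)]
  simp only [Fin.prod_univ_two, Matrix.cons_val_zero, Matrix.cons_val_one,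
    ← Polynomial.C_mul_X_pow_eq_monomial, map_mul, map_pow]
  rw [Polynomial.algebraMap_apply, Polynomial.algebraMap_apply]
  simp only [Algebra.algebraMap_self, RingHom.id_apply]
  ring

theorem coeff_coeff_slopeHom (F : MvPolynomial (Fin 2) K) (β : Fin 2 →₀ ℕ) :
    ((slopeHom F).coeff (β 0 + β 1)).coeff (β 0) = coeff β F := by
  induction F using MvPolynomial.induction_on' with
  | monomial γ c =>
    rw [slopeHom_monomial, Polynomial.coeff_monomial, coeff_monomial]
    by_cases h : γ = β
    · simp [h]
    · rw [if_neg h]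
      split_ifs with h1
      · rw [Polynomial.coeff_monomial, if_neg]
        intro h0
        refine h (Finsupp.ext fun i => ?_)
        fin_cases i
        · exact h0
        · simp only [Fin.mk_one]
          omega
      · simp
  | add p q hp hq => rw [map_add, Polynomial.coeff_add, Polynomial.coeff_add, hp, hq, coeff_add]

theorem slopeHom_ne_zero {F : MvPolynomial (Fin 2) K} (hF : F ≠ 0) : slopeHom F ≠ 0 := by
  intro h
  refine hF (MvPolynomial.ext _ _ fun β => ?_)
  rw [← coeff_coeff_slopeHom, h]
  simp

theorem totalDegree_le_natDegree_slopeHom (F : MvPolynomial (Fin 2) K) :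
    F.totalDegree ≤ (slopeHom F).natDegree := by
  refine Finset.sup_le fun β hβ => ?_
  rw [Finsupp.sum_fintype _ _ (by simp), Fin.sum_univ_two]
  refine Polynomial.le_natDegree_of_ne_zero fun h => mem_support_iff.1 hβ ?_
  rw [← coeff_coeff_slopeHom, h, Polynomial.coeff_zero]

/-- Displacing `p` by `X - p 1` in the direction `(a, 1)` parametrizes the line `x₀ = a x₁ + b` by
`x₁ = X`. -/
theorem X_pow_dvd_of_expandAt {p : Fin 2 → K} {a b : K} (hp : p 0 = a * p 1 + b) {m : ℕ}
    {F : MvPolynomial (Fin 2) K} (h : Polynomial.X ^ m ∣ expandAt p F) :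
    (Polynomial.X - Polynomial.C (p 1)) ^ m ∣
      aeval ![Polynomial.C a * Polynomial.X + Polynomial.C b, Polynomial.X] F := by
  let s : Polynomial (MvPolynomial (Fin 2) K) →+* Polynomial K :=
    Polynomial.eval₂RingHom ((aeval ![Polynomial.C a, 1] : MvPolynomial (Fin 2) K →ₐ[K]
      Polynomial K) : MvPolynomial (Fin 2) K →+* Polynomial K)
      (Polynomial.X - Polynomial.C (p 1))
  have hs : s.comp ((expandAt p : MvPolynomial (Fin 2) K →ₐ[K] _) : MvPolynomial (Fin 2) K →+* _) =
      ((aeval ![Polynomial.C a * Polynomial.X + Polynomial.C b, Polynomial.X] :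
        MvPolynomial (Fin 2) K →ₐ[K] Polynomial K) : MvPolynomial (Fin 2) K →+* Polynomial K) := by
    apply MvPolynomial.ringHom_ext
    · intro c
      simp [s, expandAt, Polynomial.algebraMap_apply, MvPolynomial.algebraMap_eq]
    · intro i
      fin_cases i
      · simp [s, expandAt, hp]
        ring
      · simp [s, expandAt]
  have := map_dvd s h
  rw [map_pow] at this
  have e := DFunLike.congr_fun hs F
  simp only [RingHom.comp_apply, RingHom.coe_coe] at e
  rw [e] at this
  simpa [s] using this

/-- Modulo the equation of the line, restricting to it and substituting `x₁` back for the parameter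
changes nothing. -/
theorem dvd_of_aeval_line_eq_zero {a b : K} {F : MvPolynomial (Fin 2) K}
    (h : aeval ![Polynomial.C a * Polynomial.X + Polynomial.C b, Polynomial.X] F = 0) :
    X 0 - C a * X 1 - C b ∣ F := by
  rw [← Ideal.mem_span_singleton, ← Ideal.Quotient.eq_zero_iff_mem]
  set I : Ideal (MvPolynomial (Fin 2) K) := Ideal.span {X 0 - C a * X 1 - C b} with hI
  have key : ((Ideal.Quotient.mkₐ K I).comp (Polynomial.aeval (X 1))).comp
      (aeval ![Polynomial.C a * Polynomial.X + Polynomial.C b, Polynomial.X]) =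
        Ideal.Quotient.mkₐ K I := by
    apply MvPolynomial.algHom_ext
    intro i
    fin_cases i
    · simp only [AlgHom.comp_apply, aeval_X, Fin.zero_eta, Matrix.cons_val_zero, map_add, map_mul,
        Polynomial.aeval_X, Polynomial.aeval_C]
      rw [← map_mul, ← map_add, Ideal.Quotient.mkₐ_eq_mk, Ideal.Quotient.eq, ← neg_mem_iff, hI]
      refine Ideal.subset_span ?_
      simp [MvPolynomial.algebraMap_eq]
      ring
    · simp
  have := DFunLike.congr_fun key F
  rw [AlgHom.comp_apply, h, map_zero] at this
  exact this.symm

/-- The right side is the degree of `F` plus the `x₀`-degree of its top form. If `F` vanishes on the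
line through `p` and `q`, dividing by its equation lowers both summands and `m` by one. Otherwise
the restriction of `F` to that line has `2m` zeros with multiplicity, so the degree alone is at
least `2m`. -/
theorem two_mul_le_of_X_pow_dvd_expandAt {p q : Fin 2 → K} (hpq : p 1 ≠ q 1) :
    ∀ (m : ℕ) (F : MvPolynomial (Fin 2) K), F ≠ 0 → Polynomial.X ^ m ∣ expandAt p F →
      Polynomial.X ^ m ∣ expandAt q F →
      2 * m ≤ (slopeHom F).natDegree + (slopeHom F).leadingCoeff.natDegree := by
  have hsub : p 1 - q 1 ≠ 0 := sub_ne_zero.2 hpq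
  obtain ⟨a, b, hp, hq⟩ : ∃ a b, p 0 = a * p 1 + b ∧ q 0 = a * q 1 + b :=
    ⟨(p 0 - q 0) / (p 1 - q 1), p 0 - (p 0 - q 0) / (p 1 - q 1) * p 1, by ring, by
      field_simp
      ring⟩
  intro m
  induction m with
  | zero => simp
  | succ m ih =>
    intro F hF h₁ h₂
    by_cases h0 : aeval ![Polynomial.C a * Polynomial.X + Polynomial.C b, Polynomial.X] F = 0
    · obtain ⟨G, rfl⟩ := dvd_of_aeval_line_eq_zero h0
      have hG : G ≠ 0 := right_ne_zero_of_mul hF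
      have hdvd (r : Fin 2 → K) (hr : r 0 = a * r 1 + b)
          (h : Polynomial.X ^ (m + 1) ∣ expandAt r ((X 0 - C a * X 1 - C b) * G)) :
          Polynomial.X ^ m ∣ expandAt r G := by
        have e : expandAt r (X 0 - C a * X 1 - C b) =
            Polynomial.X * Polynomial.C (X 0 - C a * X 1) := by
          simp [expandAt, hr, Polynomial.algebraMap_apply, MvPolynomial.algebraMap_eq]
          ring
        rw [map_mul, e, pow_succ', mul_assoc, mul_dvd_mul_iff_left Polynomial.X_ne_zero] at h
        -- The line is smooth at the point: its equation vanishes there to order exactly one.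
        refine Polynomial.prime_X.pow_dvd_of_dvd_mul_left m ?_ h
        rw [Polynomial.X_dvd_iff, Polynomial.coeff_C_zero]
        intro h
        have := congrArg (aeval ![(1 : K), 0]) h
        simp at this
      have := ih G hG (hdvd p hp h₁) (hdvd q hq h₂)
      have e : slopeHom (X 0 - C a * X 1 - C b) =
          Polynomial.C (Polynomial.X - Polynomial.C a) * Polynomial.X +
            Polynomial.C (Polynomial.C (-b)) := by
        simp [slopeHom, Polynomial.algebraMap_apply]
        ring
      have hne := Polynomial.X_sub_C_ne_zero a
      rw [map_mul, Polynomial.leadingCoeff_mul, e, Polynomial.leadingCoeff_linear hne,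
        Polynomial.natDegree_mul hne (Polynomial.leadingCoeff_ne_zero.2 (slopeHom_ne_zero hG)),
        Polynomial.natDegree_mul ?_ (slopeHom_ne_zero hG), Polynomial.natDegree_linear hne,
        Polynomial.natDegree_X_sub_C]
      · omega
      · intro h
        have := congrArg Polynomial.natDegree h
        rw [Polynomial.natDegree_linear hne] at this
        simp at this
    · have hcop : IsCoprime ((Polynomial.X - Polynomial.C (p 1)) ^ (m + 1))
          ((Polynomial.X - Polynomial.C (q 1)) ^ (m + 1)) :=
        (Polynomial.isCoprime_X_sub_C_of_isUnit_sub hsub.isUnit).pow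
      have hle := Polynomial.natDegree_le_of_dvd
        (hcop.mul_dvd (X_pow_dvd_of_expandAt hp h₁) (X_pow_dvd_of_expandAt hq h₂)) h0
      rw [Polynomial.natDegree_mul (pow_ne_zero _ (Polynomial.X_sub_C_ne_zero _))
        (pow_ne_zero _ (Polynomial.X_sub_C_ne_zero _)), Polynomial.natDegree_pow,
        Polynomial.natDegree_pow, Polynomial.natDegree_X_sub_C, Polynomial.natDegree_X_sub_C] at hle
      have hle' := MvPolynomial.aeval_natDegree_le (n := 1) F (totalDegree_le_natDegree_slopeHom F)
        ![Polynomial.C a * Polynomial.X + Polynomial.C b, Polynomial.X] (by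
          intro i
          fin_cases i
          · exact Polynomial.natDegree_linear_le
          · exact Polynomial.natDegree_X_le)
      omega

end TwoPoints

/-! ### Inequalities for the monomials of the generic initial ideals. -/

section LowerBound

attribute [local instance] MvPolynomial.gradedAlgebra

variable {K : Type*} [Field K]

theorem linearChange_isHomogeneous {k n : ℕ} (g : Fin k × Fin k → K) {f : MvPolynomial (Fin k) K}
    (hf : f.IsHomogeneous n) : (linearChange g f).IsHomogeneous n := by
  have := hf.aeval (fun i => ∑ j, C (g (i, j)) * X j : Fin k → MvPolynomial (Fin k) K) (n := 1)
    fun i => IsHomogeneous.sum _ _ _ fun j _ => isHomogeneous_C_mul_X _ _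
  rwa [one_mul] at this

theorem isHomogeneous_pow_ideal {k : ℕ} {I : Ideal (MvPolynomial (Fin k) K)}
    (hI : I.IsHomogeneous (homogeneousSubmodule (Fin k) K)) (m : ℕ) :
    (I ^ m).IsHomogeneous (homogeneousSubmodule (Fin k) K) := by
  induction m with
  | zero =>
    rw [pow_zero, Ideal.one_eq_top]
    exact Ideal.IsHomogeneous.top _
  | succ m ih =>
    rw [pow_succ]
    exact ih.mul hI

theorem coordIdeal_eq_span [Infinite K] {σ : Type*} [Fintype σ] [DecidableEq σ] (s : Finset σ) :
    coordIdeal K s = Ideal.span (X '' (s : Set σ)) := by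
  apply le_antisymm
  · intro f hf
    rw [← pow_one (coordIdeal K s), mem_coordIdeal_pow_iff] at hf
    rw [mem_ideal_span_X_image]
    intro β hβ
    by_contra! h
    have := hf β hβ
    rw [Finset.sum_eq_zero h] at this
    omega
  · rw [Ideal.span_le]
    rintro _ ⟨i, hi, rfl⟩
    exact X_mem_coordIdeal hi

theorem map_vanishingIdeal_isHomogeneous [Infinite K] {k : ℕ} {M N : Matrix (Fin k) (Fin k) K}
    (h : M * N = 1) (h' : N * M = 1) {W : Submodule K (Fin k → K)} {s : Finset (Fin k)}
    (hW : ∀ x, x ∈ W ↔ ∀ i ∈ s, M.mulVec x i = 0) (g : Fin k × Fin k → K) :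
    ((vanishingIdeal K (W : Set (Fin k → K))).map (linearChange g)).IsHomogeneous
      (homogeneousSubmodule (Fin k) K) := by
  have e : vanishingIdeal K (W : Set (Fin k → K)) =
      (coordIdeal K s).map (linearChange fun p => M p.1 p.2) := by
    apply le_antisymm
    · intro f hf
      rw [← linearChange_linearChange_of_mul_eq_one h' f]
      exact Ideal.mem_map_of_mem _ ((mem_vanishingIdeal_iff_linearChange_mem h h' hW f).1 hf)
    · rw [Ideal.map_le_iff_le_comap]
      intro f hf
      rw [Ideal.mem_comap, mem_vanishingIdeal_iff_linearChange_mem h h' hW,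
        linearChange_linearChange_of_mul_eq_one h]
      exact hf
  rw [e, coordIdeal_eq_span, Ideal.map_span, Ideal.map_span]
  refine Ideal.homogeneous_span _ _ ?_
  rintro _ ⟨_, ⟨_, ⟨i, -, rfl⟩, rfl⟩, rfl⟩
  exact ⟨1, linearChange_isHomogeneous _ (linearChange_isHomogeneous _ (isHomogeneous_X K i))⟩

theorem linearChange_mem_pow_idealOfVars {k : ℕ} (g : Fin k × Fin k → K) {n : ℕ}
    {f : MvPolynomial (Fin k) K} (hf : f ∈ idealOfVars (Fin k) K ^ n) :
    linearChange g f ∈ idealOfVars (Fin k) K ^ n := by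
  have hle : idealOfVars (Fin k) K ≤ (idealOfVars (Fin k) K).comap (linearChange g) := by
    rw [idealOfVars, Ideal.span_le]
    rintro _ ⟨i, rfl⟩
    rw [SetLike.mem_coe, Ideal.mem_comap, linearChange, aeval_X]
    exact sum_mem fun j _ => Ideal.mul_mem_left _ _ (Ideal.subset_span ⟨j, rfl⟩)
  exact Ideal.le_comap_pow _ n (Ideal.pow_right_mono hle n hf)

/-- In the adapted coordinates every monomial has degree at least `m + m`, and linear substitutions
preserve powers of the ideal of the origin. -/
theorem IsSplitting.two_mul_le_degree [Infinite K] {M N : Matrix (Fin 4) (Fin 4) K}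
    {W₁ W₂ : Submodule K (Fin 4 → K)} (h : IsSplitting M N W₁ W₂) (g : Fin 4 × Fin 4 → K) (m : ℕ)
    {f : MvPolynomial (Fin 4) K}
    (hf : f ∈ (symbolicPower (idealOfTwo W₁ W₂) m).map (linearChange g)) {α : Fin 4 →₀ ℕ}
    (hα : α ∈ f.support) : 2 * m ≤ α.degree := by
  have hle : symbolicPower (idealOfTwo W₁ W₂) m ≤
      (idealOfVars (Fin 4) K ^ (2 * m)).comap (linearChange g) := by
    intro f hf
    refine linearChange_mem_pow_idealOfVars g ?_
    rw [← linearChange_linearChange_of_mul_eq_one h.mul_eq_one' f]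
    refine linearChange_mem_pow_idealOfVars _ ?_
    rw [mem_pow_idealOfVars_iff]
    intro β hβ
    have := (h.mem_symbolicPower_iff m f).1 hf β hβ
    rw [Finsupp.degree_eq_sum, Fin.sum_univ_four]
    omega
  exact (mem_pow_idealOfVars_iff _ _).1 (Ideal.map_le_iff_le_comap.2 hle hf) α hα

/-- The substitution `x₀, x₁, x₂, x₃ ↦ x₀, x₁, 1, 0`. -/
noncomputable def restrictHom : MvPolynomial (Fin 4) K →ₐ[K] MvPolynomial (Fin 2) K :=
  aeval ![X 0, X 1, 1, 0]

theorem slopeHom_restrictHom_monomial (β : Fin 4 →₀ ℕ) (c : K) :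
    slopeHom (restrictHom (monomial β c)) = if β 3 = 0 then
      Polynomial.monomial (β 0 + β 1) (Polynomial.monomial (β 0) c) else 0 := by
  have : restrictHom (monomial β c) = C c * (X 0 ^ β 0 * X 1 ^ β 1 * 0 ^ β 3) := by
    rw [restrictHom, aeval_monomial, Finsupp.prod_fintype _ _ (by simp), Fin.prod_univ_four]
    simp [MvPolynomial.algebraMap_eq]
  rw [this]
  split_ifs with h
  · rw [h, pow_zero, mul_one]
    simp only [slopeHom, map_mul, map_pow, aeval_X, aeval_C, Matrix.cons_val_zero,
      Matrix.cons_val_one, ← Polynomial.C_mul_X_pow_eq_monomial]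
    rw [Polynomial.algebraMap_apply, Polynomial.algebraMap_apply]
    simp only [Algebra.algebraMap_self, RingHom.id_apply]
    ring
  · simp [h]

theorem coeff_slopeHom_restrictHom (f : MvPolynomial (Fin 4) K) (n a : ℕ) :
    ((slopeHom (restrictHom f)).coeff n).coeff a =
      ∑ β ∈ f.support with β 3 = 0 ∧ β 0 + β 1 = n ∧ β 0 = a, coeff β f := by
  conv_lhs => rw [f.as_sum]
  rw [map_sum, map_sum, Polynomial.finsetSum_coeff, Polynomial.finsetSum_coeff, Finset.sum_filter]
  refine Finset.sum_congr rfl fun β _ => ?_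
  rw [slopeHom_restrictHom_monomial]
  by_cases h3 : β 3 = 0
  · rw [if_pos h3, Polynomial.coeff_monomial]
    by_cases hn : β 0 + β 1 = n
    · rw [if_pos hn, Polynomial.coeff_monomial]
      simp [h3, hn]
    · simp [hn]
  · simp [h3]

/-- Among monomials of equal degree without `x₃`, the larger one has less `x₂`, that is, a larger
sum of the first two exponents; ties are broken by less `x₁`, that is, more `x₀`. -/
theorem IsLeadingExponent.le_of_isHomogeneous {f : MvPolynomial (Fin 4) K} {α β : Fin 4 →₀ ℕ}
    (hα : IsLeadingExponent f α) (hf : f.IsHomogeneous α.degree) (h3 : α 3 = 0)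
    (hβ : β ∈ f.support) (hβ3 : β 3 = 0) :
    β 0 + β 1 ≤ α 0 + α 1 ∧ (β 0 + β 1 = α 0 + α 1 → β 0 ≤ α 0) ∧
      (β 0 + β 1 = α 0 + α 1 → β 0 = α 0 → β = α) := by
  by_cases hne : β = α
  · simp [hne]
  have hdeg : β.degree = α.degree := by
    rw [← hf (mem_support_iff.1 hβ), Finsupp.degree_eq_weight_one]
    rfl
  rcases hα.2 β hβ hne with h | ⟨-, i, hi, hj⟩
  · omega
  rw [Finsupp.degree_eq_sum, Finsupp.degree_eq_sum, Fin.sum_univ_four, Fin.sum_univ_four] at hdeg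
  fin_cases i
  · have h1 := hj 1 (by decide)
    have h2 := hj 2 (by decide)
    simp only [Fin.zero_eta] at hi
    omega
  · have h2 := hj 2 (by decide)
    simp only [Fin.mk_one] at hi
    omega
  · simp only [Fin.reduceFinMk] at hi
    omega
  · simp only [Fin.reduceFinMk] at hi
    omega

/-- Setting `x₃ = 0`, `x₂ = 1` keeps the leading monomial: the restriction has degree `α 0 + α 1`,
and its top form has `x₀`-degree at most `α 0`. -/
theorem natDegree_slopeHom_restrictHom_le {f : MvPolynomial (Fin 4) K} {α : Fin 4 →₀ ℕ}
    (hα : IsLeadingExponent f α) (hf : f.IsHomogeneous α.degree) (h3 : α 3 = 0) :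
    restrictHom f ≠ 0 ∧
    (slopeHom (restrictHom f)).natDegree + (slopeHom (restrictHom f)).leadingCoeff.natDegree ≤
      2 * α 0 + α 1 := by
  have h₁ : (slopeHom (restrictHom f)).natDegree ≤ α 0 + α 1 := by
    rw [Polynomial.natDegree_le_iff_coeff_eq_zero]
    intro n hn
    ext a
    rw [coeff_slopeHom_restrictHom, Finset.sum_eq_zero, Polynomial.coeff_zero]
    intro β hβ
    simp only [Finset.mem_filter] at hβ
    have := (hα.le_of_isHomogeneous hf h3 hβ.1 hβ.2.1).1
    omega
  have h₂ : ((slopeHom (restrictHom f)).coeff (α 0 + α 1)).coeff (α 0) = coeff α f := by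
    rw [coeff_slopeHom_restrictHom, Finset.sum_eq_single_of_mem α]
    · simpa [h3] using mem_support_iff.1 hα.1
    · intro β hβ hne
      simp only [Finset.mem_filter] at hβ
      exact absurd ((hα.le_of_isHomogeneous hf h3 hβ.1 hβ.2.1).2.2 hβ.2.2.1 hβ.2.2.2) hne
  have hne := mem_support_iff.1 hα.1
  have h₃ : ((slopeHom (restrictHom f)).coeff (α 0 + α 1)).natDegree ≤ α 0 := by
    rw [Polynomial.natDegree_le_iff_coeff_eq_zero]
    intro a ha
    rw [coeff_slopeHom_restrictHom, Finset.sum_eq_zero]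
    intro β hβ
    simp only [Finset.mem_filter] at hβ
    have := (hα.le_of_isHomogeneous hf h3 hβ.1 hβ.2.1).2.1 hβ.2.2.1
    omega
  have hdeg : (slopeHom (restrictHom f)).natDegree = α 0 + α 1 := by
    refine le_antisymm h₁ (Polynomial.le_natDegree_of_ne_zero fun h0 => hne ?_)
    rw [← h₂, h0, Polynomial.coeff_zero]
  refine ⟨fun h0 => hne ?_, ?_⟩
  · rw [← h₂, h0]
    simp
  · rw [Polynomial.leadingCoeff, hdeg]
    omega

/-- For a generator of the ideal, the constant term of the expansion is its value at a point of `W`,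
hence zero. So the ideal maps into the multiples of `Polynomial.X`, and powers follow. -/
theorem X_pow_dvd_expandAt_restrictHom {W : Submodule K (Fin 4 → K)} {g : Fin 4 × Fin 4 → K}
    {p : Fin 2 → K} (hp : (Matrix.of fun i j => g (i, j)).mulVec ![p 0, p 1, 1, 0] ∈ W) {m : ℕ}
    {f : MvPolynomial (Fin 4) K}
    (hf : f ∈ (vanishingIdeal K (W : Set (Fin 4 → K))).map (linearChange g) ^ m) :
    Polynomial.X ^ m ∣ expandAt p (restrictHom f) := by
  have h0 (F : MvPolynomial (Fin 2) K) : (expandAt p F).coeff 0 = C (aeval p F) := by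
    rw [← Polynomial.constantCoeff_apply]
    have : (Polynomial.constantCoeff (R := MvPolynomial (Fin 2) K)).comp
        ((expandAt p : MvPolynomial (Fin 2) K →ₐ[K] _) : MvPolynomial (Fin 2) K →+* _) =
          C.comp ((aeval p : MvPolynomial (Fin 2) K →ₐ[K] K) : MvPolynomial (Fin 2) K →+* K) := by
      apply MvPolynomial.ringHom_ext
      · intro c
        simp [expandAt, MvPolynomial.algebraMap_eq, Polynomial.algebraMap_apply]
      · intro i
        simp [expandAt]
    exact DFunLike.congr_fun this F
  have hle : (vanishingIdeal K (W : Set (Fin 4 → K))).map (linearChange g) ≤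
      (Ideal.span {Polynomial.X}).comap ((expandAt p).comp restrictHom) := by
    rw [Ideal.map_le_iff_le_comap]
    intro f hf
    rw [Ideal.mem_comap, Ideal.mem_comap, Ideal.mem_span_singleton, AlgHom.comp_apply,
      Polynomial.X_dvd_iff, h0, restrictHom, comp_aeval_apply, aeval_linearChange]
    have hv : (fun i => ∑ j, algebraMap K K (g (i, j)) *
        aeval p ((![X 0, X 1, 1, 0] : Fin 4 → MvPolynomial (Fin 2) K) j)) =
          (Matrix.of fun i j => g (i, j)).mulVec ![p 0, p 1, 1, 0] := by
      funext i
      simp [Matrix.mulVec, dotProduct, Fin.sum_univ_four]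
    rw [hv, hf _ hp, C_0]
  have := Ideal.le_comap_pow _ m (Ideal.pow_right_mono hle m hf)
  rwa [Ideal.span_singleton_pow, Ideal.mem_comap, Ideal.mem_span_singleton] at this

/-- Cramer's rule for the intersection of a line with the plane `x₃ = 0`, in the chart `x₂ = 1`. -/
theorem exists_mulVec_eq_zero {h : Matrix (Fin 4) (Fin 4) K} {i j : Fin 4}
    (hd : h i 0 * h j 1 - h i 1 * h j 0 ≠ 0) : ∃ p : Fin 2 → K,
      (h.mulVec ![p 0, p 1, 1, 0]) i = 0 ∧ (h.mulVec ![p 0, p 1, 1, 0]) j = 0 ∧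
        p 1 = -(h i 0 * h j 2 - h j 0 * h i 2) / (h i 0 * h j 1 - h i 1 * h j 0) := by
  have hu := mul_inv_cancel₀ hd
  set u := (h i 0 * h j 1 - h i 1 * h j 0)⁻¹
  refine ⟨![(h i 1 * h j 2 - h i 2 * h j 1) * u, -(h i 0 * h j 2 - h j 0 * h i 2) * u], ?_, ?_,
    (div_eq_mul_inv _ _).symm⟩
  · simp only [Matrix.mulVec, dotProduct, Fin.sum_univ_four, Matrix.cons_val]
    linear_combination -h i 2 * hu
  · simp only [Matrix.mulVec, dotProduct, Fin.sum_univ_four, Matrix.cons_val]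
    linear_combination -h j 2 * hu

theorem IsSplitting.two_mul_le_two_mul_add [Infinite K] {M N : Matrix (Fin 4) (Fin 4) K}
    {W₁ W₂ : Submodule K (Fin 4 → K)} (h : IsSplitting M N W₁ W₂) {g : Fin 4 × Fin 4 → K}
    (hg : positionForm (M * Matrix.of fun i j => g (i, j)) ≠ 0) (m : ℕ)
    {f : MvPolynomial (Fin 4) K}
    (hf : f ∈ (symbolicPower (idealOfTwo W₁ W₂) m).map (linearChange g)) {α : Fin 4 →₀ ℕ}
    (hα : IsLeadingExponent f α) (h3 : α 3 = 0) : 2 * m ≤ 2 * α 0 + α 1 := by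
  set H := M * Matrix.of fun i j => g (i, j) with hH
  have hd₁ : H 0 0 * H 1 1 - H 0 1 * H 1 0 ≠ 0 := fun h0 => hg (by simp [positionForm, h0])
  have hd₂ : H 2 0 * H 3 1 - H 2 1 * H 3 0 ≠ 0 := fun h0 => hg (by simp [positionForm, h0])
  obtain ⟨p, hp₀, hp₁, hp⟩ := exists_mulVec_eq_zero hd₁
  obtain ⟨q, hq₀, hq₁, hq⟩ := exists_mulVec_eq_zero hd₂
  -- This is the nonvanishing of the third factor of `positionForm`.
  have hpq : p 1 ≠ q 1 := by
    intro e
    rw [hp, hq, div_eq_div_iff hd₁ hd₂] at e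
    refine right_ne_zero_of_mul hg ?_
    linear_combination e
  have hpW : (Matrix.of fun i j => g (i, j)).mulVec ![p 0, p 1, 1, 0] ∈ W₁ := by
    rw [h.mem_left, Matrix.mulVec_mulVec]
    simpa using ⟨hp₀, hp₁⟩
  have hqW : (Matrix.of fun i j => g (i, j)).mulVec ![q 0, q 1, 1, 0] ∈ W₂ := by
    rw [h.mem_right, Matrix.mulVec_mulVec]
    simpa using ⟨hq₀, hq₁⟩
  -- The element `f` need not be homogeneous; its component in the degree of `α` stays in the
  -- homogeneous ideals and keeps the leading exponent.
  let f' := homogeneousComponent α.degree f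
  have hf'mem : f' ∈ (vanishingIdeal K (W₁ : Set (Fin 4 → K))).map (linearChange g) ^ m ⊓
      (vanishingIdeal K (W₂ : Set (Fin 4 → K))).map (linearChange g) ^ m := by
    have hhom := (isHomogeneous_pow_ideal
      (map_vanishingIdeal_isHomogeneous h.1 h.2 h.3 g) m).inf (isHomogeneous_pow_ideal
      (map_vanishingIdeal_isHomogeneous h.1 h.2 h.4 g) m)
    refine homogeneousComponent_mem_of_mem hhom ?_ _
    rw [h.symbolicPower_eq] at hf
    have := Ideal.map_inf_le (linearChange g) hf
    rwa [Ideal.map_pow, Ideal.map_pow] at this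
  have hlead : IsLeadingExponent f' α := by
    have hsupp (β : Fin 4 →₀ ℕ) (hβ : β ∈ f'.support) : β ∈ f.support := by
      rw [mem_support_iff, coeff_homogeneousComponent] at hβ
      exact mem_support_iff.2 fun h0 => hβ (by rw [h0, ite_self])
    refine ⟨?_, fun β hβ => hα.2 β (hsupp β hβ)⟩
    rw [mem_support_iff, coeff_homogeneousComponent, if_pos rfl]
    exact mem_support_iff.1 hα.1
  obtain ⟨hne, hle⟩ := natDegree_slopeHom_restrictHom_le hlead
    (homogeneousComponent_isHomogeneous _ _) h3
  exact (two_mul_le_of_X_pow_dvd_expandAt hpq m _ hne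
    (X_pow_dvd_expandAt_restrictHom hpW hf'mem.1)
    (X_pow_dvd_expandAt_restrictHom hqW hf'mem.2)).trans hle

theorem IsSplitting.two_mul_le_of_mem_gin [Infinite K] {M N : Matrix (Fin 4) (Fin 4) K}
    {W₁ W₂ : Submodule K (Fin 4 → K)} (h : IsSplitting M N W₁ W₂) (m : ℕ) {α : Fin 4 →₀ ℕ}
    (hα : monomial α 1 ∈ gin (symbolicPower (idealOfTwo W₁ W₂) m)) (h3 : α 3 = 0) :
    2 * m ≤ 2 * α 0 + α 1 ∧ 2 * m ≤ α 0 + α 1 + α 2 := by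
  have hspan {T : Set (Fin 4 →₀ ℕ)} {J : Ideal (MvPolynomial (Fin 4) K)}
      (hJ : J = Ideal.span ((fun α => monomial α 1) '' T)) {γ : Fin 4 →₀ ℕ}
      (hγ : monomial γ 1 ∈ J) : ∃ δ ∈ T, δ ≤ γ := by
    rw [hJ, mem_ideal_span_monomial_image] at hγ
    exact hγ γ (by simp)
  obtain ⟨β, ⟨P, hP, hgen⟩, hβ⟩ := hspan (T := {α | Generically fun g : Fin 4 × Fin 4 → K =>
      monomial α 1 ∈ initialIdeal ((symbolicPower (idealOfTwo W₁ W₂) m).map (linearChange g))})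
    (by rw [gin]; congr 1; ext p; simp [and_comm, eq_comm]) hα
  obtain ⟨Q, hQ, hQe⟩ := exists_eval_eq_positionForm h.mul_eq_one
  -- A single `g` is generic both for the monomial `β` and for the position of the lines. The bounds
  -- are shown for a divisor of `x^α` and pass up to `α`.
  obtain ⟨g, hg⟩ : ∃ g, eval g (P * Q) ≠ 0 := by
    by_contra! h0
    exact mul_ne_zero hP hQ (MvPolynomial.funext fun x => by rw [h0, map_zero])
  rw [map_mul] at hg
  have hgQ := right_ne_zero_of_mul hg
  rw [hQe] at hgQ
  obtain ⟨γ, ⟨f, hf, hγ⟩, hle⟩ := hspan (T := {α | ∃ f ∈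
      (symbolicPower (idealOfTwo W₁ W₂) m).map (linearChange g), IsLeadingExponent f α})
    (by rw [initialIdeal]; congr 1; ext p; simp only [Set.mem_ofPred_eq, Set.mem_image]; aesop)
    (hgen g (left_ne_zero_of_mul hg))
  have hγα := hle.trans hβ
  have h₁ := h.two_mul_le_degree g m hf hγ.1
  have h₂ := h.two_mul_le_two_mul_add hgQ m hf hγ (by have := hγα 3; omega)
  rw [Finsupp.degree_eq_sum, Fin.sum_univ_four] at h₁
  have := hγα 0
  have := hγα 1
  have := hγα 2
  have := hγα 3
  omega

end LowerBound

/-! ### Inequality descriptions of the cylinder, the pyramid and their complement. -/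

section Polyhedra

theorem convex_nonneg_and_le (b c : ℝ) :
    Convex ℝ {v : Fin 3 → ℝ | (∀ i, 0 ≤ v i) ∧ b ≤ 2 * v 0 + v 1 ∧ c ≤ v 0 + v 1 + v 2} := by
  rintro x ⟨hx, hx₁, hx₂⟩ y ⟨hy, hy₁, hy₂⟩ s t hs ht hst
  refine ⟨fun i => add_nonneg (mul_nonneg hs (hx i)) (mul_nonneg ht (hy i)), ?_, ?_⟩
  · have := add_le_add (mul_le_mul_of_nonneg_left hx₁ hs) (mul_le_mul_of_nonneg_left hy₁ ht)
    simp only [Pi.add_apply, Pi.smul_apply, smul_eq_mul]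
    have e : s * b + t * b = b := by rw [← add_mul, hst, one_mul]
    linarith
  · have := add_le_add (mul_le_mul_of_nonneg_left hx₂ hs) (mul_le_mul_of_nonneg_left hy₂ ht)
    simp only [Pi.add_apply, Pi.smul_apply, smul_eq_mul]
    have e : s * c + t * c = c := by rw [← add_mul, hst, one_mul]
    linarith

theorem convex_nonneg_and_ge (b : ℝ) (a : Fin 3 → ℝ) :
    Convex ℝ {v : Fin 3 → ℝ | (∀ i, 0 ≤ v i) ∧ a 0 * v 0 + a 1 * v 1 + a 2 * v 2 ≤ b} := by
  rintro x ⟨hx, hx₁⟩ y ⟨hy, hy₁⟩ s t hs ht hst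
  refine ⟨fun i => add_nonneg (mul_nonneg hs (hx i)) (mul_nonneg ht (hy i)), ?_⟩
  have := add_le_add (mul_le_mul_of_nonneg_left hx₁ hs) (mul_le_mul_of_nonneg_left hy₁ ht)
  simp only [Pi.add_apply, Pi.smul_apply, smul_eq_mul]
  have e : s * b + t * b = b := by rw [← add_mul, hst, one_mul]
  linarith

theorem cylinder_eq : cylinder = {v : Fin 3 → ℝ | (∀ i, 0 ≤ v i) ∧ 2 * v 0 + v 1 ≤ 2} := by
  ext v
  constructor
  · rintro ⟨p, hp, s, hs, rfl⟩
    have hle : convexHull ℝ {![0, 0, 0], ![1, 0, 0], ![0, 2, 0]} ⊆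
        {v : Fin 3 → ℝ | (∀ i, 0 ≤ v i) ∧ (![2, 1, 0] : Fin 3 → ℝ) 0 * v 0 +
          (![2, 1, 0] : Fin 3 → ℝ) 1 * v 1 + (![2, 1, 0] : Fin 3 → ℝ) 2 * v 2 ≤ 2} := by
      refine convexHull_min ?_ (convex_nonneg_and_ge 2 ![2, 1, 0])
      rintro x (rfl | rfl | rfl) <;> simp [Fin.forall_fin_succ]
    obtain ⟨h₁, h₂⟩ := hle hp
    have := h₁ 0
    have := h₁ 1
    have := h₁ 2
    simp at h₂
    refine ⟨?_, ?_⟩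
    · simp [Fin.forall_fin_succ]
      refine ⟨by assumption, by assumption, by linarith⟩
    · simpa using h₂
  · rintro ⟨h₁, h₂⟩
    refine ⟨![v 0, v 1, 0], ?_, v 2, h₁ 2, ?_⟩
    · have := (convex_convexHull ℝ {![0, 0, 0], ![1, 0, 0], ![0, (2 : ℝ), 0]}).sum_mem
        (t := Finset.univ) (w := ![1 - v 0 - v 1 / 2, v 0, v 1 / 2])
        (z := ![![0, 0, 0], ![1, 0, 0], ![0, 2, 0]]) ?_ ?_ ?_
      · convert this using 1
        simp only [Fin.sum_univ_three]
        ext i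
        fin_cases i <;> simp
      · have := h₁ 0
        have := h₁ 1
        simp [Fin.forall_fin_succ]
        refine ⟨by linarith, by linarith, by linarith⟩
      · simp [Fin.sum_univ_three]
        ring
      · intro i _
        apply subset_convexHull
        fin_cases i <;> simp
    · ext i
      fin_cases i <;> simp

theorem pyramid_subset :
    pyramid ⊆ {v : Fin 3 → ℝ | (∀ i, 0 ≤ v i) ∧ v 0 + v 1 + v 2 ≤ 2} := by
  have hle : pyramid ⊆ {v : Fin 3 → ℝ | (∀ i, 0 ≤ v i) ∧ (![1, 1, 1] : Fin 3 → ℝ) 0 * v 0 +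
      (![1, 1, 1] : Fin 3 → ℝ) 1 * v 1 + (![1, 1, 1] : Fin 3 → ℝ) 2 * v 2 ≤ 2} := by
    refine convexHull_min ?_ (convex_nonneg_and_ge 2 ![1, 1, 1])
    rintro x (rfl | rfl | rfl | rfl)
    all_goals
      simp [Fin.forall_fin_succ]
      try norm_num
  intro v hv
  simpa using hle hv

theorem mem_pyramid {v : Fin 3 → ℝ} (h : ∀ i, 0 ≤ v i) (h₁ : 2 ≤ 2 * v 0 + v 1)
    (h₂ : v 0 + v 1 + v 2 ≤ 2) : v ∈ pyramid := by
  have := (convex_convexHull ℝ {![1, 0, 0], ![2, 0, 0], ![0, 2, 0], ![1, 0, (1 : ℝ)]}).sum_mem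
    -- Barycentric coordinates of `v` in the tetrahedron.
    (t := Finset.univ) (w := ![2 - v 0 - v 1 - v 2, v 0 + v 1 / 2 - 1, v 1 / 2, v 2])
    (z := ![![1, 0, 0], ![2, 0, 0], ![0, 2, 0], ![1, 0, 1]]) ?_ ?_ ?_
  · rw [pyramid]
    convert this using 1
    simp only [Fin.sum_univ_four]
    ext i
    fin_cases i <;> simp
    ring
  · have := h 0
    have := h 1
    have := h 2
    simp [Fin.forall_fin_succ]
    refine ⟨by linarith, by linarith, by linarith, by linarith⟩
  · simp [Fin.sum_univ_four]
    ring
  · intro i _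
    apply subset_convexHull
    fin_cases i <;> simp

/-- The remaining facet inequality `2 v₀ + v₁ ≥ 2` of the pyramid can be dropped, since the cylinder
covers the other side. -/
theorem cylinder_union_pyramid_eq : cylinder ∪ pyramid =
    {v : Fin 3 → ℝ | (∀ i, 0 ≤ v i) ∧ (2 * v 0 + v 1 ≤ 2 ∨ v 0 + v 1 + v 2 ≤ 2)} := by
  rw [cylinder_eq]
  ext v
  constructor
  · rintro (⟨h, h₁⟩ | hv)
    · exact ⟨h, Or.inl h₁⟩
    · exact ⟨(pyramid_subset hv).1, Or.inr (pyramid_subset hv).2⟩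
  · rintro ⟨h, h₁⟩
    by_cases h₂ : 2 * v 0 + v 1 ≤ 2
    · exact Or.inl ⟨h, h₂⟩
    · exact Or.inr (mem_pyramid h (by linarith) (h₁.resolve_left h₂))

theorem closure_nonneg_and_lt :
    closure {v : Fin 3 → ℝ | (∀ i, 0 ≤ v i) ∧ (2 * v 0 + v 1 < 2 ∨ v 0 + v 1 + v 2 < 2)} =
      {v : Fin 3 → ℝ | (∀ i, 0 ≤ v i) ∧ (2 * v 0 + v 1 ≤ 2 ∨ v 0 + v 1 + v 2 ≤ 2)} := by
  apply subset_antisymm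
  · refine closure_minimal (fun v hv => ⟨hv.1, hv.2.imp le_of_lt le_of_lt⟩) ?_
    have e : {v : Fin 3 → ℝ | (∀ i, 0 ≤ v i) ∧ (2 * v 0 + v 1 ≤ 2 ∨ v 0 + v 1 + v 2 ≤ 2)} =
        (⋂ i, {v | 0 ≤ v i}) ∩ ({v | 2 * v 0 + v 1 ≤ 2} ∪ {v | v 0 + v 1 + v 2 ≤ 2}) := by
      ext v
      simp
    rw [e]
    refine (isClosed_iInter fun i => isClosed_le continuous_const (continuous_apply i)).inter
      (IsClosed.union ?_ ?_)
    · exact isClosed_le (by fun_prop) continuous_const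
    · exact isClosed_le (by fun_prop) continuous_const
  · rintro v ⟨h, h₁⟩
    -- Shrinking `v` towards the origin makes the weak inequalities strict.
    have hlim : Tendsto (fun t : ℝ => t • v) (𝓝[<] 1) (𝓝 v) := by
      have : Tendsto (fun t : ℝ => t • v) (𝓝 1) (𝓝 ((1 : ℝ) • v)) :=
        (continuous_id.smul continuous_const).tendsto 1
      rw [one_smul] at this
      exact this.mono_left nhdsWithin_le_nhds
    refine mem_closure_of_tendsto hlim ?_
    filter_upwards [Ioo_mem_nhdsLT (show (0 : ℝ) < 1 by norm_num)] with t ht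
    refine ⟨fun i => mul_nonneg ht.1.le (h i), h₁.imp (fun h₁ => ?_) fun h₁ => ?_⟩
    · simp only [Pi.smul_apply, smul_eq_mul]
      nlinarith [ht.1, ht.2]
    · simp only [Pi.smul_apply, smul_eq_mul]
      nlinarith [ht.1, ht.2]

theorem mem_convexHull_of_orthants_subset {E : Set (Fin 3 → ℝ)}
    (hE : ∀ p ∈ ({![2, 0, 0], ![0, 2, 0], ![1, 0, 1]} : Set (Fin 3 → ℝ)), ∀ v, p ≤ v → v ∈ E)
    {v : Fin 3 → ℝ} (h : ∀ i, 0 ≤ v i) (h₁ : 2 ≤ 2 * v 0 + v 1) (h₂ : 2 ≤ v 0 + v 1 + v 2) :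
    v ∈ convexHull ℝ E := by
  -- Weights of a convex combination of the three vertices lying below `v`. When `v 1 < 2`, take `b
  -- = v 1 / 2` and `c` as large as `v 2` and the total weight allow.
  obtain ⟨a, b, c, ha, hb, hc, habc, h0, h1, h2⟩ : ∃ a b c : ℝ, 0 ≤ a ∧ 0 ≤ b ∧ 0 ≤ c ∧
      a + b + c = 1 ∧ 2 * a + c ≤ v 0 ∧ 2 * b ≤ v 1 ∧ c ≤ v 2 := by
    have := h 0
    have := h 1
    have := h 2
    by_cases hv1 : 2 ≤ v 1
    · exact ⟨0, 1, 0, by norm_num, by norm_num, by norm_num, by norm_num, by linarith, by linarith,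
        by linarith⟩
    · by_cases hv2 : 1 - v 1 / 2 ≤ v 2
      · exact ⟨0, v 1 / 2, 1 - v 1 / 2, by linarith, by linarith, by linarith, by linarith,
          by linarith, by linarith, by linarith⟩
      · exact ⟨1 - v 1 / 2 - v 2, v 1 / 2, v 2, by linarith, by linarith, by linarith, by linarith,
          by linarith, by linarith, by linarith⟩
  set w : Fin 3 → ℝ := v - ![2 * a + c, 2 * b, c] with hw
  have hw0 : 0 ≤ w := by
    intro i
    refine sub_nonneg.2 ?_
    fin_cases i
    · exact h0
    · exact h1
    · exact h2
  have := (convex_convexHull ℝ E).sum_mem (t := Finset.univ) (w := ![a, b, c])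
    (z := ![![2, 0, 0] + w, ![0, 2, 0] + w, ![1, 0, 1] + w]) ?_ ?_ ?_
  · convert this using 1
    simp only [Fin.sum_univ_three]
    have e : v = ![2 * a + c, 2 * b, c] + (a + b + c) • w := by
      rw [habc, one_smul, hw]
      abel
    conv_lhs => rw [e]
    ext i
    fin_cases i <;> simp [Matrix.vecHead, Matrix.vecTail] <;> ring
  · simp [Fin.forall_fin_succ, ha, hb, hc]
  · simpa [Fin.sum_univ_three] using habc
  · intro i _
    apply subset_convexHull
    fin_cases i
    · exact hE ![2, 0, 0] (by simp) _ (le_add_of_nonneg_right hw0)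
    · exact hE ![0, 2, 0] (by simp) _ (le_add_of_nonneg_right hw0)
    · exact hE ![1, 0, 1] (by simp) _ (le_add_of_nonneg_right hw0)

end Polyhedra

/-! ### The computation of `Γ(I)`. -/

section Region

variable {K : Type*} [Field K] [Infinite K] {M N : Matrix (Fin 4) (Fin 4) K}
  {W₁ W₂ : Submodule K (Fin 4 → K)}

theorem IsSplitting.symbolicPower_one (h : IsSplitting M N W₁ W₂) :
    symbolicPower (idealOfTwo W₁ W₂) 1 = idealOfTwo W₁ W₂ := by
  rw [h.symbolicPower_eq, pow_one, pow_one, idealOfTwo_eq_inf]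

theorem IsSplitting.convexHull_exponentRegion_subset (h : IsSplitting M N W₁ W₂) (m : ℕ) :
    convexHull ℝ (exponentRegion (n := 3) (idealOfTwo W₁ W₂) m) ⊆
      {v : Fin 3 → ℝ | (∀ i, 0 ≤ v i) ∧ 2 * (m : ℝ) ≤ 2 * v 0 + v 1 ∧
        2 * (m : ℝ) ≤ v 0 + v 1 + v 2} := by
  refine convexHull_min ?_ (convex_nonneg_and_le _ _)
  rintro v ⟨α, h3, hα, hle⟩
  obtain ⟨h₁, h₂⟩ := h.two_mul_le_of_mem_gin m hα h3
  have h0 : (α 0 : ℝ) ≤ v 0 := hle 0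
  have h1 : (α 1 : ℝ) ≤ v 1 := hle 1
  have h2 : (α 2 : ℝ) ≤ v 2 := hle 2
  have h₁' : 2 * (m : ℝ) ≤ 2 * α 0 + α 1 := by exact_mod_cast h₁
  have h₂' : 2 * (m : ℝ) ≤ α 0 + α 1 + α 2 := by exact_mod_cast h₂
  exact ⟨fun i => (Nat.cast_nonneg _).trans (hle i), by linarith, by linarith⟩

theorem IsSplitting.mem_convexHull_exponentRegion_one (h : IsSplitting M N W₁ W₂)
    {v : Fin 3 → ℝ} (hv : ∀ i, 0 ≤ v i) (h₁ : 2 ≤ 2 * v 0 + v 1) (h₂ : 2 ≤ v 0 + v 1 + v 2) :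
    v ∈ convexHull ℝ (exponentRegion (n := 3) (idealOfTwo W₁ W₂) 1) := by
  have hgin := h.span_le_gin
  rw [span_quadrics_eq] at hgin
  have hmem (i j : Fin 4) (hi : i ≠ 3) (hj : j ≠ 3) (hij : Finsupp.single i 1 + Finsupp.single j 1 ∈
      ({Finsupp.single 0 1 + Finsupp.single 2 1, Finsupp.single 1 1 + Finsupp.single 1 1,
        Finsupp.single 0 1 + Finsupp.single 1 1, Finsupp.single 0 1 + Finsupp.single 0 1} :
          Set (Fin 4 →₀ ℕ))) (v : Fin 3 → ℝ) (hv : ∀ l : Fin 3,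
        (((Finsupp.single i 1 + Finsupp.single j 1 : Fin 4 →₀ ℕ) l.castSucc : ℕ) : ℝ) ≤ v l) :
      v ∈ exponentRegion (n := 3) (idealOfTwo W₁ W₂) 1 := by
    refine ⟨Finsupp.single i 1 + Finsupp.single j 1, ?_, ?_, hv⟩
    · change (Finsupp.single i 1 + Finsupp.single j 1 : Fin 4 →₀ ℕ) 3 = 0
      simp [hi.symm, hj.symm]
    · rw [h.symbolicPower_one]
      exact hgin (Ideal.subset_span ⟨_, hij, rfl⟩)
  refine mem_convexHull_of_orthants_subset ?_ hv h₁ h₂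
  rintro p (rfl | rfl | rfl) v hpv
  · refine hmem 0 0 (by decide) (by decide) (by simp) v fun l => le_of_eq_of_le ?_ (hpv l)
    fin_cases l <;> norm_num [Finsupp.single_apply]
  · refine hmem 1 1 (by decide) (by decide) (by simp) v fun l => le_of_eq_of_le ?_ (hpv l)
    fin_cases l <;> norm_num [Finsupp.single_apply]
  · refine hmem 0 2 (by decide) (by decide) (by simp) v fun l => le_of_eq_of_le ?_ (hpv l)
    fin_cases l <;> norm_num [Finsupp.single_apply]
    rfl

theorem IsSplitting.gam_eq (h : IsSplitting M N W₁ W₂) :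
    Gam (n := 3) (idealOfTwo W₁ W₂) = cylinder ∪ pyramid := by
  rw [cylinder_union_pyramid_eq, ← closure_nonneg_and_lt, Gam]
  congr 1
  ext v
  simp only [Set.mem_iInter, Set.mem_sdiff]
  constructor
  · intro hv
    -- The region for `m = 1` is already the whole polyhedron, so no other `m` removes more.
    obtain ⟨h0, h1⟩ := hv 1 le_rfl
    refine ⟨h0, ?_⟩
    by_contra! hcon
    refine h1 ?_
    rw [Nat.cast_one, inv_one, one_smul]
    exact h.mem_convexHull_exponentRegion_one h0 hcon.1 hcon.2
  · rintro ⟨h0, h1⟩ m hm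
    refine ⟨h0, ?_⟩
    rintro ⟨u, hu, rfl⟩
    obtain ⟨-, h₁, h₂⟩ := h.convexHull_exponentRegion_subset m hu
    have hm' : (0 : ℝ) < m := by exact_mod_cast hm
    simp only [Pi.smul_apply, smul_eq_mul] at h1
    have e (x : ℝ) (hx : 2 * (m : ℝ) ≤ x) : 2 ≤ (m : ℝ)⁻¹ * x := by
      rw [← div_eq_inv_mul, le_div_iff₀ hm']
      exact hx
    have e₁ := e _ h₁
    have e₂ := e _ h₂
    rcases h1 with h1 | h1 <;> nlinarith

end Region

/-! ### Hilbert functions of the symbolic powers and their asymptotics. -/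

section HilbertPolynomial

/-- Indices for the monomials `x₀ ^ i x₁ ^ (a - i) x₂ ^ j x₃ ^ (t - a - j)` of degree `t` whose
degree `a` in the first two or degree `t - a` in the last two variables is less than `m`. -/
def standardIndices (m t : ℕ) : Finset (Σ _ : ℕ, ℕ × ℕ) :=
  {a ∈ Finset.range (t + 1) | a < m ∨ t - a < m}.sigma
    fun a => Finset.range (a + 1) ×ˢ Finset.range (t - a + 1)

/-- The exponents of degree `t` whose degree in the first two or in the last two variables is less
than `m`. -/
noncomputable def standardExponents (m t : ℕ) : Finset (Fin 4 →₀ ℕ) :=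
  (standardIndices m t).image fun x =>
    Finsupp.equivFunOnFinite.symm ![x.2.1, x.1 - x.2.1, x.2.2, t - x.1 - x.2.2]

theorem mem_standardExponents {m t : ℕ} {β : Fin 4 →₀ ℕ} :
    β ∈ standardExponents m t ↔ β.degree = t ∧ ¬(m ≤ β 0 + β 1 ∧ m ≤ β 2 + β 3) := by
  rw [Finsupp.degree_eq_sum, Fin.sum_univ_four, standardExponents, Finset.mem_image]
  constructor
  · rintro ⟨⟨a, i, j⟩, h, rfl⟩
    simp [standardIndices] at h
    simp
    omega
  · rintro ⟨h₁, h₂⟩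
    refine ⟨⟨β 0 + β 1, β 0, β 2⟩, ?_, ?_⟩
    · simp [standardIndices]
      omega
    · ext i
      fin_cases i <;> simp
      omega

/-- The bound on `t` makes the conditions `a < m` and `t - a < m` exclusive; the symmetry `a ↦ t -
a` gives the factor `2`. -/
theorem card_standardExponents {m t : ℕ} (h : 2 * m ≤ t) :
    (standardExponents m t).card = 2 * ∑ a ∈ Finset.range m, (a + 1) * (t - a + 1) := by
  rw [standardExponents, Finset.card_image_of_injOn, standardIndices, Finset.card_sigma]
  · simp only [Finset.card_product, Finset.card_range]
    rw [Finset.filter_or, Finset.sum_union, two_mul]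
    · congr 1
      · refine Finset.sum_congr ?_ fun _ _ => rfl
        ext a
        simp
        omega
      · refine Finset.sum_nbij' (fun a => t - a) (fun a => t - a) ?_ ?_ ?_ ?_ ?_
        · intro a ha
          simp at ha ⊢
          omega
        · intro a ha
          simp at ha ⊢
          omega
        · intro a ha
          simp at ha
          omega
        · intro a ha
          simp at ha
          omega
        · intro a ha
          simp at ha
          rw [Nat.sub_sub_self (by omega), mul_comm]
    · rw [Finset.disjoint_left]
      intro a ha hb
      simp at ha hb
      omega
  · rintro ⟨a, i, j⟩ hx ⟨b, k, l⟩ hy hxy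
    simp [standardIndices] at hx hy
    have e (n : Fin 4) := congrFun (Finsupp.equivFunOnFinite.symm.injective hxy) n
    have e0 : i = k := e 0
    have e1 : a - i = b - k := e 1
    have e2 : j = l := e 2
    obtain rfl := e0
    obtain rfl := e2
    obtain rfl : a = b := by omega
    rfl

variable {K : Type*} [Field K] [Infinite K] {M N : Matrix (Fin 4) (Fin 4) K}
  {W₁ W₂ : Submodule K (Fin 4 → K)}

theorem IsSplitting.hilbertFunction_eq (h : IsSplitting M N W₁ W₂) (m t : ℕ) :
    hilbertFunction (symbolicPower (idealOfTwo W₁ W₂) m) t = (standardExponents m t).card := by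
  -- In the adapted coordinates the ideal is monomial, so its degree `t` part is the common kernel
  -- of the coefficients at the standard exponents.
  let L : homogeneousSubmodule (Fin 4) K t →ₗ[K] (standardExponents m t → K) :=
    LinearMap.pi fun β => (lcoeff K β.1 ∘ₗ (linearChange fun p => N p.1 p.2).toLinearMap) ∘ₗ
      (homogeneousSubmodule (Fin 4) K t).subtype
  have hL (f : homogeneousSubmodule (Fin 4) K t) (β : standardExponents m t) :
      L f β = coeff β.1 (linearChange (fun p => N p.1 p.2) f.1) := rfl
  have hker : ((symbolicPower (idealOfTwo W₁ W₂) m).restrictScalars K).comap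
      (homogeneousSubmodule (Fin 4) K t).subtype = LinearMap.ker L := by
    ext f
    rw [Submodule.mem_comap, Submodule.restrictScalars_mem, Submodule.subtype_apply,
      h.mem_symbolicPower_iff, LinearMap.mem_ker]
    constructor
    · intro hf
      ext β
      by_contra hne
      exact (mem_standardExponents.1 β.2).2 (hf β (mem_support_iff.2 hne))
    · intro hf β hβ
      by_contra hcon
      refine mem_support_iff.1 hβ (congrFun hf ⟨β, mem_standardExponents.2 ⟨?_, hcon⟩⟩)
      rw [← linearChange_isHomogeneous _ ((mem_homogeneousSubmodule _ _).1 f.2)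
        (mem_support_iff.1 hβ), Finsupp.degree_eq_weight_one]
      rfl
  have hsurj : Function.Surjective L := by
    intro c
    have hhom : (∑ β : standardExponents m t, monomial β.1 (c β)).IsHomogeneous t :=
      IsHomogeneous.sum _ _ _ fun β _ =>
        isHomogeneous_monomial _ (mem_standardExponents.1 β.2).1
    refine ⟨⟨linearChange (fun p => M p.1 p.2) _, linearChange_isHomogeneous _ hhom⟩, ?_⟩
    ext β
    rw [hL, linearChange_linearChange_of_mul_eq_one h.mul_eq_one, coeff_sum,
      Finset.sum_eq_single_of_mem β (Finset.mem_univ _), coeff_monomial, if_pos rfl]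
    intro γ _ hne
    rw [coeff_monomial, if_neg (fun e => hne (Subtype.ext e))]
  rw [hilbertFunction, hker, (L.quotKerEquivOfSurjective hsurj).finrank_eq, Module.finrank_pi,
    Fintype.card_coe]

/-- The Hilbert polynomial of the `m`-th symbolic power of the ideal of two disjoint lines. -/
noncomputable def twoLinesHilbertPolynomial (m : ℕ) : Polynomial ℝ :=
  ∑ a ∈ Finset.range m, Polynomial.C (2 * ((a : ℝ) + 1)) *
    (Polynomial.X + Polynomial.C (1 - (a : ℝ)))

theorem eval_twoLinesHilbertPolynomial (m : ℕ) (x : ℝ) :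
    (twoLinesHilbertPolynomial m).eval x =
      m * (m + 1) * x + 2 * m - (m - 1) * m * (2 * m - 1) / 3 := by
  induction m with
  | zero => simp [twoLinesHilbertPolynomial]
  | succ m ih =>
    rw [twoLinesHilbertPolynomial] at ih ⊢
    rw [Finset.sum_range_succ, Polynomial.eval_add, ih]
    simp
    ring

theorem IsSplitting.isHilbertPolynomial (h : IsSplitting M N W₁ W₂) (m : ℕ) :
    IsHilbertPolynomial (symbolicPower (idealOfTwo W₁ W₂) m) (twoLinesHilbertPolynomial m) := by
  filter_upwards [eventually_ge_atTop (2 * m)] with t ht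
  rw [h.hilbertFunction_eq, card_standardExponents ht, twoLinesHilbertPolynomial,
    Polynomial.eval_finsetSum]
  push_cast
  rw [Finset.mul_sum]
  refine Finset.sum_congr rfl fun a ha => ?_
  rw [Nat.cast_sub (by have := Finset.mem_range.1 ha; omega)]
  simp
  ring

theorem tendsto_twoLinesHilbertPolynomial (t : ℝ) :
    Tendsto (fun m : ℕ => (twoLinesHilbertPolynomial m).eval ((m : ℝ) * t) / (m : ℝ) ^ 3) atTop
      (𝓝 (t - 2 / 3)) := by
  -- This is the normalized Hilbert polynomial written in `u = 1 / m`.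
  have hcont : Continuous fun u : ℝ => (1 + u) * t + 2 * u ^ 2 - (1 - u) * (2 - u) / 3 := by
    fun_prop
  have hlim := (hcont.tendsto 0).comp (tendsto_inv_atTop_nhds_zero_nat (𝕜 := ℝ))
  have e : (1 + 0) * t + 2 * (0 : ℝ) ^ 2 - (1 - 0) * (2 - 0) / 3 = t - 2 / 3 := by ring
  rw [e] at hlim
  refine hlim.congr' ?_
  filter_upwards [eventually_ge_atTop 1] with m hm
  have hm' : (m : ℝ) ≠ 0 := by positivity
  rw [eval_twoLinesHilbertPolynomial, Function.comp_apply]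
  field_simp

theorem IsSplitting.isAsymptoticHilbertPolynomial (h : IsSplitting M N W₁ W₂) :
    IsAsymptoticHilbertPolynomial (n := 3) (idealOfTwo W₁ W₂) (fun t => t - 2 / 3) :=
  ⟨twoLinesHilbertPolynomial, h.isHilbertPolynomial, tendsto_twoLinesHilbertPolynomial⟩

end HilbertPolynomial

end AsymptoticHilbert

theorem mainTheorem8 {K : Type*} [Field K] [IsAlgClosed K] [CharZero K] :
    (∀ W₁ W₂ : Submodule K (Fin 4 → K), AsymptoticHilbert.AreDisjointLines W₁ W₂ →
      AsymptoticHilbert.IsAsymptoticHilbertPolynomial (n := 3)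
          (AsymptoticHilbert.idealOfTwo W₁ W₂) (fun t => t - 2 / 3) ∧
        AsymptoticHilbert.Gam (n := 3) (AsymptoticHilbert.idealOfTwo W₁ W₂) =
          AsymptoticHilbert.cylinder ∪ AsymptoticHilbert.pyramid ∧
        Ideal.span {X 0 * X 2, X 1 ^ 2, X 0 * X 1, X 0 ^ 2} ≤
          AsymptoticHilbert.gin (AsymptoticHilbert.idealOfTwo W₁ W₂)) ∧
    AsymptoticHilbert.Generically (fun a : Fin 4 × Fin 4 → K =>
      AsymptoticHilbert.AreDisjointLines
          (Submodule.span K {fun j => a (0, j), fun j => a (1, j)})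
          (Submodule.span K {fun j => a (2, j), fun j => a (3, j)}) ∧
        Ideal.span {X 0 * X 2, X 1 ^ 2, X 0 * X 1, X 0 ^ 2} ≤
          AsymptoticHilbert.initialIdeal (AsymptoticHilbert.idealOfTwo
            (Submodule.span K {fun j => a (0, j), fun j => a (1, j)})
            (Submodule.span K {fun j => a (2, j), fun j => a (3, j)}))) := by
  refine ⟨fun W₁ W₂ hW => ?_, AsymptoticHilbert.generically_span_le_initialIdeal⟩
  obtain ⟨M, N, h⟩ := hW.exists_isSplitting
  exact ⟨h.isAsymptoticHilbertPolynomial, h.gam_eq, h.span_le_gin⟩
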